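/- **Setting.** Let $f:\mathbb R^d\to\mathbb R$ be twice continuously differentiable, with gradient $g(x)=\nabla f(x)$ and Hessian $H(x)=\nabla^2 f(x)$; consider $\min f(x)$ subject to $x\ge 0$. Let $\mathcal P(x)=\max(x,0)$ componentwise. For $\delta>0$ put $\mathcal A(x,\delta)=\{i: 0\le x^i\le\delta\}$ and $\mathcal I(x,\delta)=\{i: x^i>\delta\}$; for an index set $J$, $v^J$ is the subvector of $v$ and $H^J$ the principal submatrix of $H$ with indices in $J$. A point $x$ is *$\epsilon$-FO* if, with $\mathcal A=\mathcal A(x,\sqrt\epsilon)$ and $\mathcal I=\mathcal I(x,\sqrt\epsilon)$, $$g^i\ge-\sqrt\epsilon\ \ (i\in\mathcal A),\qquad \|\mathrm{diag}(x^{\mathcal A})g^{\mathcal A}\|\le\epsilon,\qquad \|g^{\mathcal I}\|\le\epsilon .$$ **MINRES$(H,g,\eta,0)$.** Let $s^{(t)}$ minimise $\|Hs+g\|^2$ over $\mathcal K_t(H,g)=\mathrm{span}\{g,Hg,\dots,H^{t-1}g\}$ and let $r^{(t)}=-Hs^{(t)}-g$. For $t=1,2,\dots$: if $r^{(t-1)}\ne0$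 and $\langle r^{(t-1)},Hr^{(t-1)}\rangle\le0$, return $(r^{(t-1)},\mathrm{NPC})$; otherwise, if $\|Hr^{(t-1)}\|\le\eta\|Hs^{(t-1)}\|$, return $(s^{(t-1)},\mathrm{SOL})$. Let $T_t$ be the symmetric tridiagonal matrix generated by the first $t$ steps of the Lanczos process for $(H,g)$ (by all of its steps, if it terminates earlier). **Algorithm.** Parameters: $\rho\in(0,\tfrac12)$, $\theta>0$, $\zeta\in(0,1)$, tolerances $\delta_k,\epsilon_k>0$, and $x_0\ge0$. At iteration $k$ let $\mathcal A=\mathcal A(x_k,\delta_k)$, $\mathcal I=\mathcal I(x_k,\delta_k)$, $g_k=g(x_k)$, $H_k=H(x_k)$. 1. If $\mathcal A\neq\emptyset$ and ($g_k^i<-\epsilon_k$ for some $i\in\mathcal A$, or $\|\mathrm{diag}(x_k^{\mathcal A})g_k^{\mathcal A}\|>\epsilon_k^2$), the step is of Type I; else if $\mathcal I\ne\emptyset$ and $\|g_k^{\mathcal I}\|>\epsilon_k^2$, it is of Type II; else terminate. 2. Set $p_k^{\mathcal A}=-g_k^{\mathcal A}$ for Type I and $p_k^{\mathcal A}=0$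 for Type II, and let $(p_k^{\mathcal I},D)$ be the output of MINRES$(H_k^{\mathcal I},g_k^{\mathcal I},\theta\epsilon_k,0)$. 3. The line search criterion for a step size $\alpha$ is $$f(\mathcal P(x_k+\alpha p_k))-f(x_k)\le\rho\langle g_k^{\mathcal A},\mathcal P(x_k^{\mathcal A}+\alpha p_k^{\mathcal A})-x_k^{\mathcal A}\rangle+\alpha\rho\langle g_k^{\mathcal I},p_k^{\mathcal I}\rangle .$$ If $D=\mathrm{SOL}$, or if $\alpha=1$ violates the criterion, $\alpha_k$ is the first of $1,\zeta,\zeta^2,\dots$ that satisfies it. If $D=\mathrm{NPC}$ and $\alpha=1$ satisfies it, $\alpha_k=\zeta\cdot\zeta^{-n}$, where $\zeta^{-n}$ is the first of $1,\zeta^{-1},\zeta^{-2},\dots$ that violates it. 4. Set $x_{k+1}=\mathcal P(x_k+\alpha_kp_k)$. **Theorem.** Let $L_g,L_H\ge0$, $\omega,\sigma,\theta>0$, $\rho\in(0,\tfrac12)$, $\zeta\in(0,1)$ and $\Delta\in\mathbb R$. There is a constant $C$, depending only on these numbers (in particular not on $d$ or $\epsilon_g$), such that the following holds for every $\epsilon_g\in(0,1)$,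 when $\delta_k=\epsilon_k=\epsilon_g^{1/2}$ for all $k$. Suppose that * $\|g(x)-g(y)\|\le L_g\|x-y\|$ and $\|H(x)-H(y)\|\le L_H\|x-y\|$ (spectral norm) for all $x,y\in\mathbb R^d_+$; * $f(x)\ge f_*>-\infty$ for all $x\in\mathbb R^d_+$, and $f(x_0)-f_*\le\Delta$; * every NPC direction $r$ that MINRES returns in the course of the algorithm, at an iterate $x_k$, satisfies $\|r\|\ge\omega\|g_k^{\mathcal I}\|$; * whenever MINRES returns a SOL step in the course of the algorithm, in its iteration $t$ say, $T_t\succeq\sigma\mathbf I$. Then every iteration of the algorithm is well defined (MINRES and the line searches terminate), and the algorithm terminates after at most $C\,\epsilon_g^{-3/2}$ iterations, at a point $x_K\ge0$ that is $\epsilon_g$-FO. -/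

import Mathlib

namespace NewtonMR

open scoped Gradient

/-! ### Krylov subspaces, MINRES and the Lanczos process -/

section Krylov

variable {V : Type*} [NormedAddCommGroup V] [InnerProductSpace ℝ V]

/-- The Krylov subspace `K_t(H, g) = span {g, H g, …, H^(t-1) g}`. -/
def krylov (H : V →ₗ[ℝ] V) (g : V) (t : ℕ) : Submodule ℝ V :=
  Submodule.span ℝ (Set.range fun j : Fin t => (H ^ (j : ℕ)) g)

/-- `s` is the `t`-th MINRES iterate: it minimises `‖H s + g‖²` over `K_t(H, g)`. -/
def IsMinresIterate (H : V →ₗ[ℝ] V) (g : V) (t : ℕ) (s : V) : Prop :=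
  s ∈ krylov H g t ∧ ∀ y ∈ krylov H g t, ‖H s + g‖ ^ 2 ≤ ‖H y + g‖ ^ 2

/-- The residual `r = -H s - g`. -/
def minresResidual (H : V →ₗ[ℝ] V) (g s : V) : V := -(H s) - g

/-- Nonpositive curvature test with tolerance `ς`. A curvature direction is by definition a nonzero
vector, so a vanishing residual (an exact solution of the linear system) is not reported as one. -/
def NPCDetected (H : V →ₗ[ℝ] V) (ς : ℝ) (r : V) : Prop :=
  r ≠ 0 ∧ inner ℝ r (H r) ≤ ς * ‖r‖ ^ 2

/-- The inexactness test `‖H r‖ ≤ η ‖H s‖` of MINRES. -/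
def MinresAccurate (H : V →ₗ[ℝ] V) (g : V) (η : ℝ) (s : V) : Prop :=
  ‖H (minresResidual H g s)‖ ≤ η * ‖H s‖

/-- The two kinds of output of MINRES. -/
inductive DType where
  | SOL : DType
  | NPC : DType

/-- MINRES, run on `(H, g)` with inexactness tolerance `η` and curvature tolerance `ς`, returns
`(p, D)` in its iteration `t ≥ 1`. In iteration `j + 1` the curvature test is applied first, to the
residual of the iterate `s j`; if it succeeds, that residual is returned with label `NPC`. If it
fails, the inexactness test is applied, and if this succeeds, `s j` is returned with label `SOL`. -/
def MinresReturns (H : V →ₗ[ℝ] V) (g : V) (η ς : ℝ) (t : ℕ) (p : V) (D : DType) : Prop :=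
  1 ≤ t ∧ ∃ s : ℕ → V,
    (∀ j < t, IsMinresIterate H g j (s j)) ∧
    (∀ j, j + 1 < t →
      ¬ NPCDetected H ς (minresResidual H g (s j)) ∧ ¬ MinresAccurate H g η (s j)) ∧
    match D with
    | DType.NPC => NPCDetected H ς (minresResidual H g (s (t - 1))) ∧ p = minresResidual H g (s (t - 1))
    | DType.SOL => ¬ NPCDetected H ς (minresResidual H g (s (t - 1))) ∧
        MinresAccurate H g η (s (t - 1)) ∧ p = s (t - 1)

/-- The Lanczos process: the triple `(v_t, v_{t+1}, β_{t+1})`, where `v_0 = 0`, `v_1 = g / ‖g‖`,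
`q_t = H v_t - β_t v_{t-1} - ⟨v_t, H v_t⟩ v_t`, `β_{t+1} = ‖q_t‖`, `v_{t+1} = q_t / β_{t+1}`.
If the process has terminated (`q_t = 0`), all later vectors are `0`. -/
noncomputable def lanczos (H : V →ₗ[ℝ] V) (g : V) : ℕ → V × V × ℝ
  | 0 => (0, ‖g‖⁻¹ • g, ‖g‖)
  | t + 1 =>
    let u := (lanczos H g t).1
    let v := (lanczos H g t).2.1
    let b := (lanczos H g t).2.2
    let q := H v - b • u - (inner ℝ v (H v) : ℝ) • v
    (v, ‖q‖⁻¹ • q, ‖q‖)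

/-- The Lanczos vector `v_t`. It is nonzero exactly when `t ≥ 1` and the process has not terminated
before its `t`-th step. -/
noncomputable def lanczosVec (H : V →ₗ[ℝ] V) (g : V) (t : ℕ) : V := (lanczos H g t).1

/-- The diagonal coefficient `α_t = ⟨v_t, H v_t⟩`. -/
noncomputable def lanczosDiag (H : V →ₗ[ℝ] V) (g : V) (t : ℕ) : ℝ :=
  inner ℝ (lanczosVec H g t) (H (lanczosVec H g t))

/-- The off-diagonal coefficient `β_{t+1} = ‖q_t‖`. -/
noncomputable def lanczosOff (H : V →ₗ[ℝ] V) (g : V) (t : ℕ) : ℝ := (lanczos H g t).2.2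

/-- The symmetric tridiagonal Lanczos matrix `T_t`, with diagonal `α_1, …, α_t` and off-diagonal
`β_2, …, β_t` (rows and columns are numbered from `0` here). -/
noncomputable def lanczosT (H : V →ₗ[ℝ] V) (g : V) (t : ℕ) : Matrix (Fin t) (Fin t) ℝ :=
  Matrix.of fun i j =>
    if i = j then lanczosDiag H g (i + 1)
    else if (i : ℕ) + 1 = j then lanczosOff H g (i + 1)
    else if (j : ℕ) + 1 = i then lanczosOff H g (j + 1)
    else 0

/-- `T_t ⪰ σ I`, where `T_t` stands for the matrix of the last Lanczos step that is performed up to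
iteration `t`. (The matrices `T_1, T_2, …` are nested leading principal blocks, so the inequality for
the last one is the inequality for all of them.) -/
def LanczosBoundedBelow (H : V →ₗ[ℝ] V) (g : V) (t : ℕ) (σ : ℝ) : Prop :=
  ∀ m ≤ t, lanczosVec H g m ≠ 0 →
    (lanczosT H g m - σ • (1 : Matrix (Fin m) (Fin m) ℝ)).PosSemidef

end Krylov

/-! ### Line searches -/

/-- Backtracking line search from `α₀`: `α` is the first of `α₀, ζ α₀, ζ² α₀, …` that satisfies
the criterion. -/
def BacktrackReturns (crit : ℝ → Prop) (ζ α₀ α : ℝ) : Prop :=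
  ∃ n : ℕ, α = ζ ^ n * α₀ ∧ crit α ∧ ∀ m < n, ¬ crit (ζ ^ m * α₀)

/-- Forward/backward tracking line search from `α₀`: backtracking if `α₀` fails the criterion;
otherwise the step size is divided by `ζ` until the criterion fails for the first time, and
`ζ` times the failing step size is returned. -/
def ForwardReturns (crit : ℝ → Prop) (ζ α₀ α : ℝ) : Prop :=
  (¬ crit α₀ ∧ BacktrackReturns crit ζ α₀ α) ∨
  (crit α₀ ∧ ∃ n : ℕ, ¬ crit (α₀ / ζ ^ n) ∧ (∀ m < n, crit (α₀ / ζ ^ m)) ∧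
    α = ζ * (α₀ / ζ ^ n))

/-! ### The two-metric projection method -/

section Algorithm

variable {d : ℕ}

/-- The nonnegative orthant of `ℝ^d`. -/
def orthant (d : ℕ) : Set (EuclideanSpace ℝ (Fin d)) := {x | ∀ i, 0 ≤ x i}

/-- The Euclidean projection onto the nonnegative orthant. -/
noncomputable def proj (x : EuclideanSpace ℝ (Fin d)) : EuclideanSpace ℝ (Fin d) :=
  WithLp.toLp 2 fun i => max (x i) 0

/-- The `δ`-active set `{i | 0 ≤ x_i ≤ δ}`. -/
noncomputable def activeSet (x : EuclideanSpace ℝ (Fin d)) (δ : ℝ) : Finset (Fin d) :=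
  Finset.univ.filter fun i => 0 ≤ x i ∧ x i ≤ δ

/-- The `δ`-inactive set `{i | x_i > δ}`. -/
noncomputable def inactiveSet (x : EuclideanSpace ℝ (Fin d)) (δ : ℝ) : Finset (Fin d) :=
  Finset.univ.filter fun i => δ < x i

/-- The subvector `v^J` of the components with index in `J`. -/
noncomputable def subvec (J : Finset (Fin d)) (v : EuclideanSpace ℝ (Fin d)) :
    EuclideanSpace ℝ J :=
  WithLp.toLp 2 fun i => v i

/-- The Hessian of `f` at `x`, as the derivative of the gradient map. -/
noncomputable def hess (f : EuclideanSpace ℝ (Fin d) → ℝ) (x : EuclideanSpace ℝ (Fin d)) :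
    EuclideanSpace ℝ (Fin d) →L[ℝ] EuclideanSpace ℝ (Fin d) :=
  fderiv ℝ (gradient f) x

/-- The principal submatrix of the Hessian with rows and columns in `J`. -/
noncomputable def subHessMatrix (f : EuclideanSpace ℝ (Fin d) → ℝ) (J : Finset (Fin d))
    (x : EuclideanSpace ℝ (Fin d)) : Matrix J J ℝ :=
  Matrix.of fun i j => (hess f x (EuclideanSpace.single (j : Fin d) (1 : ℝ))) i

/-- The submatrix `H(x)^J` as a linear map. -/
noncomputable def subHess (f : EuclideanSpace ℝ (Fin d) → ℝ) (J : Finset (Fin d))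
    (x : EuclideanSpace ℝ (Fin d)) : EuclideanSpace ℝ J →ₗ[ℝ] EuclideanSpace ℝ J :=
  Matrix.toEuclideanLin (subHessMatrix f J x)

/-- `g^i ≥ -a` on the `δ`-active set. -/
def ActiveSignCond (f : EuclideanSpace ℝ (Fin d) → ℝ) (δ a : ℝ)
    (x : EuclideanSpace ℝ (Fin d)) : Prop :=
  ∀ i ∈ activeSet x δ, -a ≤ gradient f x i

/-- `‖diag(x^A) g^A‖ ≤ b` for the `δ`-active set `A`. -/
def ActiveNormCond (f : EuclideanSpace ℝ (Fin d) → ℝ) (δ b : ℝ)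
    (x : EuclideanSpace ℝ (Fin d)) : Prop :=
  ‖subvec (activeSet x δ) (WithLp.toLp 2 fun i => x i * gradient f x i)‖ ≤ b

/-- `‖g^I‖ ≤ b` for the `δ`-inactive set `I`. -/
def InactiveNormCond (f : EuclideanSpace ℝ (Fin d) → ℝ) (δ b : ℝ)
    (x : EuclideanSpace ℝ (Fin d)) : Prop :=
  ‖subvec (inactiveSet x δ) (gradient f x)‖ ≤ b

/-- `e`-approximate first-order optimal points. (The conditions hold trivially on empty sets.) -/
def IsFO (f : EuclideanSpace ℝ (Fin d) → ℝ) (e : ℝ) (x : EuclideanSpace ℝ (Fin d)) : Prop :=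
  ActiveSignCond f (√e) (√e) x ∧ ActiveNormCond f (√e) e x ∧ InactiveNormCond f (√e) e x

/-- The two kinds of steps. -/
inductive StepType where
  | typeI : StepType
  | typeII : StepType

open Classical in
/-- The flag chosen by the algorithm at `x` with active set tolerance `δ` and optimality tolerance
`ε` (so that the optimality conditions read `g^i ≥ -ε`, `‖diag(x^A) g^A‖ ≤ ε²`, `‖g^I‖ ≤ ε²`);
`none` means that it terminates. -/
noncomputable def flag (f : EuclideanSpace ℝ (Fin d) → ℝ) (δ ε : ℝ)
    (x : EuclideanSpace ℝ (Fin d)) : Option StepType :=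
  if (activeSet x δ).Nonempty ∧ (¬ ActiveSignCond f δ ε x ∨ ¬ ActiveNormCond f δ (ε ^ 2) x) then
    some StepType.typeI
  else if (inactiveSet x δ).Nonempty ∧ ¬ InactiveNormCond f δ (ε ^ 2) x then
    some StepType.typeII
  else none

/-- The full direction: `q` on the inactive set; off it, `-g` for a Type I step and `0` for a
Type II step. -/
noncomputable def direction (f : EuclideanSpace ℝ (Fin d) → ℝ) (δ : ℝ)
    (x : EuclideanSpace ℝ (Fin d)) (F : StepType) (q : EuclideanSpace ℝ (inactiveSet x δ)) :
    EuclideanSpace ℝ (Fin d) :=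
  WithLp.toLp 2 fun i =>
    if h : i ∈ inactiveSet x δ then q ⟨i, h⟩
    else match F with
      | StepType.typeI => -(gradient f x i)
      | StepType.typeII => 0

/-- The line search criterion at step size `α` for the direction `p`. -/
def LineSearchCriterion (f : EuclideanSpace ℝ (Fin d) → ℝ) (ρ δ : ℝ)
    (x p : EuclideanSpace ℝ (Fin d)) (α : ℝ) : Prop :=
  f (proj (x + α • p)) - f x ≤
    ρ * (∑ i ∈ activeSet x δ, gradient f x i * (proj (x + α • p) i - x i)) +
      α * ρ * (∑ i ∈ inactiveSet x δ, gradient f x i * p i)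

/-- The call of MINRES at `x`, on the inactive block of the Hessian and of the gradient, with
inexactness tolerance `η = ε θ` and curvature tolerance `0`, returns `(q, D)` in iteration `t`. -/
def MinresCall (f : EuclideanSpace ℝ (Fin d) → ℝ) (θ δ ε : ℝ) (x : EuclideanSpace ℝ (Fin d))
    (t : ℕ) (q : EuclideanSpace ℝ (inactiveSet x δ)) (D : DType) : Prop :=
  MinresReturns (subHess f (inactiveSet x δ) x) (subvec (inactiveSet x δ) (gradient f x))
    (ε * θ) 0 t q D

/-- One iteration of the method leads from `x` to `x'`. -/
def AlgStep (f : EuclideanSpace ℝ (Fin d) → ℝ) (ρ ζ θ δ ε : ℝ)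
    (x x' : EuclideanSpace ℝ (Fin d)) : Prop :=
  ∃ (F : StepType) (t : ℕ) (q : EuclideanSpace ℝ (inactiveSet x δ)) (D : DType) (α : ℝ),
    flag f δ ε x = some F ∧
    MinresCall f θ δ ε x t q D ∧
    (match D with
      | DType.SOL => BacktrackReturns (LineSearchCriterion f ρ δ x (direction f δ x F q)) ζ 1 α
      | DType.NPC => ForwardReturns (LineSearchCriterion f ρ δ x (direction f δ x F q)) ζ 1 α) ∧
    x' = proj (x + α • direction f δ x F q)

/-- `IsIterate f ρ ζ θ δ ε x₀ k x`: the method, started at `x₀` with tolerance sequences `δ` and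
`ε`, performs at least `k` iterations, and `x` is its `k`-th iterate. -/
inductive IsIterate (f : EuclideanSpace ℝ (Fin d) → ℝ) (ρ ζ θ : ℝ) (δ ε : ℕ → ℝ)
    (x₀ : EuclideanSpace ℝ (Fin d)) : ℕ → EuclideanSpace ℝ (Fin d) → Prop
  | zero : IsIterate f ρ ζ θ δ ε x₀ 0 x₀
  | succ {k : ℕ} {x x' : EuclideanSpace ℝ (Fin d)} :
      IsIterate f ρ ζ θ δ ε x₀ k x → AlgStep f ρ ζ θ (δ k) (ε k) x x' →
      IsIterate f ρ ζ θ δ ε x₀ (k + 1) x'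

/-- Every NPC direction `r` that MINRES returns in the course of the method satisfies
`‖r‖ ≥ ω ‖g^I‖`. -/
def NPCResidualBound (f : EuclideanSpace ℝ (Fin d) → ℝ) (ρ ζ θ : ℝ) (δ ε : ℕ → ℝ)
    (x₀ : EuclideanSpace ℝ (Fin d)) (ω : ℝ) : Prop :=
  ∀ k x, IsIterate f ρ ζ θ δ ε x₀ k x → flag f (δ k) (ε k) x ≠ none →
    ∀ t q, MinresCall f θ (δ k) (ε k) x t q DType.NPC →
      ω * ‖subvec (inactiveSet x (δ k)) (gradient f x)‖ ≤ ‖q‖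

/-- Whenever MINRES returns a SOL step in the course of the method, say in its iteration `t`, the
Lanczos matrix satisfies `T_t ⪰ σ I`. -/
def KrylovRegularity (f : EuclideanSpace ℝ (Fin d) → ℝ) (ρ ζ θ : ℝ) (δ ε : ℕ → ℝ)
    (x₀ : EuclideanSpace ℝ (Fin d)) (σ : ℝ) : Prop :=
  ∀ k x, IsIterate f ρ ζ θ δ ε x₀ k x → flag f (δ k) (ε k) x ≠ none →
    ∀ t q, MinresCall f θ (δ k) (ε k) x t q DType.SOL →
      LanczosBoundedBelow (subHess f (inactiveSet x (δ k)) x)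
        (subvec (inactiveSet x (δ k)) (gradient f x)) t σ

end Algorithm

end NewtonMR

/-!
The objective is shown to decrease by a multiple of `ε³`, `ε = √εg`, in every iteration, except for
some Type II steps that are never followed by another Type II step. Since the total decrease is at
most `Δ`, this bounds the number of iterations by a multiple of `ε⁻³ = εg^(-3/2)`.

**MINRES.** Residuals satisfy `r_n ⟂ H K_n`; hence they are `H`-conjugate and `⟨r_i, r_n⟩ = ‖r_n‖²`
for `i ≤ n`. While their curvature is positive they form a basis of the Krylov space, which gives
termination (`exists_minresReturns`), and the coefficients of `s_n` in this basis are nonnegative, so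
`⟨s_n, r_n⟩ ≥ 0` (`inner_iterate_residual_nonneg`), that is, `⟨g, s_n⟩ ≤ -⟨s_n, H s_n⟩`. As the
Lanczos vectors are an orthonormal basis of the Krylov space, `T_t ⪰ σ I` is the coercivity of `H` on
`K_t`; applied to the step `p` and to its residual, it gives `⟨g, p⟩ ≤ -σ ‖p‖²` and
`‖H p + g‖ ≤ (θ ε / σ) ‖H p‖` (`MinresReturns.sol_regular`).

**Line search.** If `α ‖q‖ ≤ δ`, where `q` is the inactive part of the direction, then no inactive
component leaves the orthant. Under this condition the criterion holds for `α` below a constant, by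
a first order estimate (`criterion_of_small`); this settles termination and Type I steps. For Type II
steps, the active components do not move, and a second order estimate gives the longer step sizes of
`criterion_typeII_sol` and `criterion_typeII_npc`. Each lower bound on the accepted `α` comes from the
rejected step size `α / ζ`.

**Decrease.** A Type I step gains `min(α, 1) ε² / 2` on the active block, which suffices when `α` is
at least of order `ε`; if `α` is smaller, then `‖q‖ ≥ 1` and the inactive block gains enough
(`typeI_decrease`). A Type II step with label NPC gains enough because `‖q‖ ≥ ω ε²`
(`typeII_npc_decrease`). A Type II step with label SOL gains enough unless `α = 1` and `‖q‖` is below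
a multiple of `ε`; then the new inactive gradient is at most `(θ Lg / σ) ε ‖q‖ + LH ‖q‖² ≤ ε²`, and
the next step is not of Type II (`typeII_sol_decrease`).
-/

namespace NewtonMR

/-! ### MINRES residuals -/

section Minres

variable {V : Type*} [NormedAddCommGroup V] [InnerProductSpace ℝ V]

lemma krylov_mono (H : V →ₗ[ℝ] V) (g : V) {m n : ℕ} (h : m ≤ n) :
    krylov H g m ≤ krylov H g n := by
  refine Submodule.span_le.2 ?_
  rintro _ ⟨j, rfl⟩
  exact Submodule.subset_span ⟨⟨j, j.2.trans_le h⟩, rfl⟩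

lemma map_mem_krylov (H : V →ₗ[ℝ] V) (g : V) {n : ℕ} {y : V} (hy : y ∈ krylov H g n) :
    H y ∈ krylov H g (n + 1) := by
  have : krylov H g n ≤ (krylov H g (n + 1)).comap H := by
    refine Submodule.span_le.2 ?_
    rintro _ ⟨j, rfl⟩
    refine Submodule.subset_span ⟨⟨j + 1, by omega⟩, ?_⟩
    simp [pow_succ']
  exact this hy

lemma self_mem_krylov (H : V →ₗ[ℝ] V) (g : V) {n : ℕ} (hn : 0 < n) : g ∈ krylov H g n :=
  Submodule.subset_span ⟨⟨0, hn⟩, by simp⟩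

lemma minresResidual_mem_krylov (H : V →ₗ[ℝ] V) (g : V) {n : ℕ} {s : V}
    (hs : s ∈ krylov H g n) : minresResidual H g s ∈ krylov H g (n + 1) :=
  sub_mem (neg_mem (map_mem_krylov H g hs)) (self_mem_krylov H g n.succ_pos)

instance finiteDimensional_krylov (H : V →ₗ[ℝ] V) (g : V) (n : ℕ) :
    FiniteDimensional ℝ (krylov H g n) :=
  FiniteDimensional.span_of_finite ℝ (Set.finite_range _)

lemma finrank_krylov_le (H : V →ₗ[ℝ] V) (g : V) (n : ℕ) :
    Module.finrank ℝ (krylov H g n) ≤ n := by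
  have h := finrank_range_le_card (R := ℝ) fun j : Fin n => (H ^ (j : ℕ)) g
  rwa [Fintype.card_fin] at h

lemma exists_isMinresIterate (H : V →ₗ[ℝ] V) (g : V) (n : ℕ) :
    ∃ s, IsMinresIterate H g n s := by
  obtain ⟨v, hv, hmin⟩ := Submodule.exists_norm_eq_iInf_of_complete_subspace
    ((krylov H g n).map H) (Submodule.complete_of_finiteDimensional _) (-g)
  obtain ⟨s, hs, rfl⟩ := hv
  refine ⟨s, hs, fun y hy => ?_⟩
  have h := ciInf_le (f := fun w : (krylov H g n).map H => ‖-g - (w : V)‖)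
    ⟨0, by rintro _ ⟨w, rfl⟩; exact norm_nonneg _⟩ ⟨H y, Submodule.mem_map_of_mem hy⟩
  replace h := hmin.le.trans h
  have e : ∀ z : V, ‖-g - H z‖ = ‖H z + g‖ := fun z => by
    rw [← norm_neg]; congr 1; abel
  simp only [e] at h
  gcongr

/-- The first order condition of the least squares problem solved by MINRES: the residual is
orthogonal to `H K_n`. -/
lemma IsMinresIterate.inner_residual_map {H : V →ₗ[ℝ] V} {g : V} {n : ℕ} {s : V}
    (hs : IsMinresIterate H g n s) {y : V} (hy : y ∈ krylov H g n) :
    inner ℝ (minresResidual H g s) (H y) = 0 := by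
  set a := H s + g with ha
  set b := H y with hb
  have hr : minresResidual H g s = -a := by simp [minresResidual, ha]; abel
  rw [hr, inner_neg_left, neg_eq_zero]
  set w : ℝ := inner ℝ a b with hw
  have key : ∀ c : ℝ, 0 ≤ 2 * c * w + c ^ 2 * ‖b‖ ^ 2 := by
    intro c
    have h := hs.2 (s + c • y) (add_mem hs.1 (Submodule.smul_mem _ c hy))
    have e : H (s + c • y) + g = a + c • b := by simp [ha, hb]; abel
    rw [e, norm_add_sq_real a, real_inner_smul_right, norm_smul, mul_pow, Real.norm_eq_abs, sq_abs] at h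
    linarith
  have hn : 0 < ‖b‖ ^ 2 + 1 := by positivity
  have h := key (-w / (‖b‖ ^ 2 + 1))
  have e : 2 * (-w / (‖b‖ ^ 2 + 1)) * w + (-w / (‖b‖ ^ 2 + 1)) ^ 2 * ‖b‖ ^ 2
      = -(w ^ 2 * (‖b‖ ^ 2 + 2)) / (‖b‖ ^ 2 + 1) ^ 2 := by
    field_simp; ring
  rw [e, le_div_iff₀ (by positivity)] at h
  have : w ^ 2 = 0 := by nlinarith [sq_nonneg w, sq_nonneg (‖b‖), mul_nonneg (sq_nonneg w) (sq_nonneg ‖b‖)]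
  exact pow_eq_zero_iff two_ne_zero |>.1 this

lemma inner_residual_residual {H : V →ₗ[ℝ] V} {g : V} {s : ℕ → V} {i j : ℕ} (hij : i ≤ j)
    (hi : IsMinresIterate H g i (s i)) (hj : IsMinresIterate H g j (s j)) :
    inner ℝ (minresResidual H g (s i)) (minresResidual H g (s j))
      = ‖minresResidual H g (s j)‖ ^ 2 := by
  have h := hj.inner_residual_map (sub_mem hj.1 (krylov_mono H g hij hi.1))
  have e : minresResidual H g (s i) = H (s j - s i) + minresResidual H g (s j) := by
    simp only [minresResidual, map_sub]; abel
  rw [e, inner_add_left, real_inner_comm, h, zero_add, real_inner_self_eq_norm_sq]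

lemma inner_residual_map_residual {H : V →ₗ[ℝ] V} {g : V} {s : ℕ → V} {i j : ℕ} (hij : i < j)
    (hi : IsMinresIterate H g i (s i)) (hj : IsMinresIterate H g j (s j)) :
    inner ℝ (minresResidual H g (s j)) (H (minresResidual H g (s i))) = 0 :=
  hj.inner_residual_map (krylov_mono H g hij (minresResidual_mem_krylov H g hi.1))

lemma norm_residual_anti {H : V →ₗ[ℝ] V} {g : V} {s : ℕ → V} {i j : ℕ} (hij : i ≤ j)
    (hi : IsMinresIterate H g i (s i)) (hj : IsMinresIterate H g j (s j)) :
    ‖minresResidual H g (s j)‖ ^ 2 ≤ ‖minresResidual H g (s i)‖ ^ 2 := by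
  have e : ∀ z : V, ‖minresResidual H g z‖ = ‖H z + g‖ := fun z => by
    rw [← norm_neg, minresResidual]; congr 1; abel
  simp only [e]
  exact hj.2 _ (krylov_mono H g hij hi.1)

lemma minresResidual_zero_iterate {H : V →ₗ[ℝ] V} {g : V} {s : V}
    (hs : IsMinresIterate H g 0 s) : minresResidual H g s = -g := by
  have : s = 0 := by simpa [krylov] using hs.1
  simp [this, minresResidual]

/-- MINRES residuals of positive curvature are `H`-conjugate, hence linearly independent. -/
lemma linearIndependent_residual {H : V →ₗ[ℝ] V} (hH : H.IsSymmetric) {g : V} {s : ℕ → V} {n : ℕ}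
    (hs : ∀ j < n, IsMinresIterate H g j (s j))
    (hpos : ∀ j < n, 0 < inner ℝ (minresResidual H g (s j)) (H (minresResidual H g (s j)))) :
    LinearIndependent ℝ fun j : Fin n => minresResidual H g (s j) := by
  rw [Fintype.linearIndependent_iff]
  intro c hc i
  have h : inner ℝ (∑ j : Fin n, c j • minresResidual H g (s j)) (H (minresResidual H g (s i)))
      = c i * inner ℝ (minresResidual H g (s i)) (H (minresResidual H g (s i))) := by
    rw [sum_inner, Finset.sum_eq_single i]
    · rw [real_inner_smul_left]
    · intro j _ hj
      rw [real_inner_smul_left]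
      rcases lt_or_gt_of_ne hj with hlt | hlt
      · rw [← hH, real_inner_comm, inner_residual_map_residual hlt (hs _ j.2) (hs _ i.2), mul_zero]
      · rw [inner_residual_map_residual hlt (hs _ i.2) (hs _ j.2), mul_zero]
    · simp
  rw [hc, inner_zero_left] at h
  rcases mul_eq_zero.1 h.symm with h | h
  · exact h
  · exact absurd h (hpos i i.2).ne'

/-- As long as MINRES has met no nonpositive curvature, `⟨s_n, r_n⟩ ≥ 0`. Indeed the earlier
residuals form an `H`-conjugate basis of the Krylov space, in which `s_n` has the coefficients
`(‖r_i‖² - ‖r_n‖²) / ⟨r_i, H r_i⟩ ≥ 0`, while `⟨r_i, r_n⟩ = ‖r_n‖²`. -/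
lemma inner_iterate_residual_nonneg {H : V →ₗ[ℝ] V} (hH : H.IsSymmetric) {g : V} {s : ℕ → V}
    {n : ℕ} (hs : ∀ j ≤ n, IsMinresIterate H g j (s j))
    (hpos : ∀ j < n, 0 < inner ℝ (minresResidual H g (s j)) (H (minresResidual H g (s j)))) :
    0 ≤ inner ℝ (s n) (minresResidual H g (s n)) := by
  set r : ℕ → V := fun j => minresResidual H g (s j) with hr
  have hli := linearIndependent_residual hH (fun j hj => hs j (Nat.le_of_lt hj)) hpos
  have hspan : Submodule.span ℝ (Set.range fun j : Fin n => r j) = krylov H g n := by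
    refine Submodule.eq_of_le_of_finrank_le ?_ ?_
    · refine Submodule.span_le.2 ?_
      rintro _ ⟨j, rfl⟩
      exact krylov_mono H g j.2 (minresResidual_mem_krylov H g (hs j j.2.le).1)
    · rw [finrank_span_eq_card hli, Fintype.card_fin]
      exact finrank_krylov_le H g n
  have hmem : s n ∈ Submodule.span ℝ (Set.range fun j : Fin n => r j) :=
    hspan ▸ (hs n le_rfl).1
  obtain ⟨c, hc⟩ := (Submodule.mem_span_range_iff_exists_fun ℝ).1 hmem
  have hc0 : ∀ i, 0 ≤ c i := by
    intro i
    have h1 : inner ℝ (s n) (H (r i)) = c i * inner ℝ (r i) (H (r i)) := by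
      rw [← hc, sum_inner, Finset.sum_eq_single i]
      · rw [real_inner_smul_left]
      · intro j _ hj
        rw [real_inner_smul_left]
        rcases lt_or_gt_of_ne hj with hlt | hlt
        · rw [← hH, real_inner_comm,
            inner_residual_map_residual hlt (hs _ j.2.le) (hs _ i.2.le), mul_zero]
        · rw [inner_residual_map_residual hlt (hs _ i.2.le) (hs _ j.2.le), mul_zero]
      · simp
    have h2 : inner ℝ (s n) (H (r i)) = ‖r i‖ ^ 2 - ‖r n‖ ^ 2 := by
      have e : H (s n) = r 0 - r n := by
        simp only [hr]
        rw [minresResidual_zero_iterate (hs 0 n.zero_le), minresResidual]; abel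
      rw [← hH, e, inner_sub_left, inner_residual_residual i.1.zero_le (hs 0 n.zero_le)
        (hs i i.2.le), real_inner_comm, inner_residual_residual i.2.le (hs i i.2.le) (hs n le_rfl)]
    have h3 := norm_residual_anti i.2.le (hs i i.2.le) (hs n le_rfl)
    have h4 : 0 ≤ c i * inner ℝ (r i) (H (r i)) := by
      rw [← h1, h2]; linarith
    exact nonneg_of_mul_nonneg_left h4 (hpos i i.2)
  have : inner ℝ (s n) (r n) = ∑ i : Fin n, c i * ‖r n‖ ^ 2 := by
    conv_lhs => rw [← hc]
    rw [sum_inner]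
    refine Finset.sum_congr rfl fun i _ => ?_
    rw [real_inner_smul_left, inner_residual_residual i.2.le (hs i i.2.le) (hs n le_rfl)]
  rw [this]
  exact Finset.sum_nonneg fun i _ => mul_nonneg (hc0 i) (sq_nonneg _)

lemma curvature_pos_of_not_returned {H : V →ₗ[ℝ] V} {g s : V} {η : ℝ} (hη : 0 ≤ η)
    (h1 : ¬ NPCDetected H 0 (minresResidual H g s)) (h2 : ¬ MinresAccurate H g η s) :
    0 < inner ℝ (minresResidual H g s) (H (minresResidual H g s)) := by
  have hne : minresResidual H g s ≠ 0 := by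
    intro h
    refine h2 ?_
    rw [MinresAccurate, h, map_zero, norm_zero]
    positivity
  by_contra hcon
  exact h1 ⟨hne, by simpa using hcon⟩

/-- MINRES terminates: residuals of positive curvature are linearly independent. -/
lemma exists_minresReturns [FiniteDimensional ℝ V] {H : V →ₗ[ℝ] V} (hH : H.IsSymmetric) (g : V)
    {η : ℝ} (hη : 0 ≤ η) : ∃ t p D, MinresReturns H g η 0 t p D := by
  classical
  choose s hs using exists_isMinresIterate H g
  have hex : ∃ n, NPCDetected H 0 (minresResidual H g (s n)) ∨ MinresAccurate H g η (s n) := by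
    by_contra hcon
    push Not at hcon
    have hli := linearIndependent_residual hH (n := Module.finrank ℝ V + 1) (fun j _ => hs j)
      fun j _ => curvature_pos_of_not_returned hη (hcon j).1 (hcon j).2
    have := hli.fintype_card_le_finrank
    simp at this
  have hmin : ∀ j, j + 1 < Nat.find hex + 1 →
      ¬ NPCDetected H 0 (minresResidual H g (s j)) ∧ ¬ MinresAccurate H g η (s j) := by
    intro j hj
    have := Nat.find_min hex (by omega : j < Nat.find hex)
    tauto
  by_cases hN : NPCDetected H 0 (minresResidual H g (s (Nat.find hex)))
  · exact ⟨Nat.find hex + 1, _, DType.NPC, by omega, s, fun j _ => hs j, hmin, hN, rfl⟩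
  · exact ⟨Nat.find hex + 1, _, DType.SOL, by omega, s, fun j _ => hs j, hmin, hN,
      (Nat.find_spec hex).resolve_left hN, rfl⟩

lemma MinresReturns.npc_spec {H : V →ₗ[ℝ] V} {g : V} {η : ℝ} {t : ℕ} {p : V}
    (h : MinresReturns H g η 0 t p DType.NPC) :
    p ≠ 0 ∧ inner ℝ p (H p) ≤ 0 ∧ inner ℝ g p = -‖p‖ ^ 2 := by
  obtain ⟨ht, s, hs, -, hN, rfl⟩ := h
  refine ⟨hN.1, by simpa using hN.2, ?_⟩
  have h := inner_residual_residual (t - 1).zero_le (hs 0 ht) (hs (t - 1) (by omega))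
  rw [minresResidual_zero_iterate (hs 0 ht), inner_neg_left] at h
  linarith

/-- A SOL step is at least as good a descent direction as its curvature demands, and both the step
and its residual lie in the Krylov space of the iteration in which it is returned. -/
lemma MinresReturns.sol_spec {H : V →ₗ[ℝ] V} (hH : H.IsSymmetric) {g : V} {η : ℝ} (hη : 0 ≤ η)
    {t : ℕ} {p : V} (h : MinresReturns H g η 0 t p DType.SOL) :
    inner ℝ g p ≤ -inner ℝ p (H p) ∧ MinresAccurate H g η p ∧ p ∈ krylov H g t ∧
      minresResidual H g p ∈ krylov H g t := by
  obtain ⟨ht, s, hs, hn, -, hacc, rfl⟩ := h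
  have h1 := inner_iterate_residual_nonneg hH (n := t - 1) (fun j hj => hs j (by omega))
    fun j hj => curvature_pos_of_not_returned hη (hn j (by omega)).1 (hn j (by omega)).2
  refine ⟨?_, hacc, krylov_mono H g (Nat.sub_le t 1) (hs _ (by omega)).1, ?_⟩
  · rw [minresResidual, inner_sub_right, inner_neg_right, real_inner_comm g] at h1
    linarith
  · have := minresResidual_mem_krylov H g (hs (t - 1) (by omega)).1
    rwa [Nat.sub_add_cancel ht] at this

end Minres

/-! ### The Lanczos process -/

section Lanczos

variable {V : Type*} [NormedAddCommGroup V] [InnerProductSpace ℝ V]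

lemma lanczosVec_zero (H : V →ₗ[ℝ] V) (g : V) : lanczosVec H g 0 = 0 := rfl

lemma lanczosVec_one (H : V →ₗ[ℝ] V) (g : V) : lanczosVec H g 1 = ‖g‖⁻¹ • g := rfl

lemma lanczosVec_add_two (H : V →ₗ[ℝ] V) (g : V) (n : ℕ) :
    lanczosVec H g (n + 2) = (lanczosOff H g (n + 1))⁻¹ •
      (H (lanczosVec H g (n + 1)) - lanczosOff H g n • lanczosVec H g n
        - lanczosDiag H g (n + 1) • lanczosVec H g (n + 1)) := rfl

lemma lanczosOff_succ (H : V →ₗ[ℝ] V) (g : V) (n : ℕ) :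
    lanczosOff H g (n + 1) =
      ‖H (lanczosVec H g (n + 1)) - lanczosOff H g n • lanczosVec H g n
        - lanczosDiag H g (n + 1) • lanczosVec H g (n + 1)‖ := rfl

/-- The three-term recurrence. It also holds after termination, where all vectors vanish. -/
lemma map_lanczosVec (H : V →ₗ[ℝ] V) (g : V) (n : ℕ) :
    H (lanczosVec H g (n + 1)) = lanczosOff H g (n + 1) • lanczosVec H g (n + 2) +
      lanczosDiag H g (n + 1) • lanczosVec H g (n + 1) + lanczosOff H g n • lanczosVec H g n := by
  set q := H (lanczosVec H g (n + 1)) - lanczosOff H g n • lanczosVec H g n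
        - lanczosDiag H g (n + 1) • lanczosVec H g (n + 1) with hq
  have h : lanczosOff H g (n + 1) • lanczosVec H g (n + 2) = q := by
    rw [lanczosVec_add_two, lanczosOff_succ, ← hq]
    by_cases h0 : q = 0
    · simp [h0]
    · rw [smul_smul, mul_inv_cancel₀ (norm_ne_zero_iff.2 h0), one_smul]
  rw [h, hq]; abel

lemma norm_inv_norm_smul (q : V) : ‖‖q‖⁻¹ • q‖ = 1 ∨ ‖q‖⁻¹ • q = 0 := by
  by_cases h : q = 0
  · right; simp [h]
  · left; rw [norm_smul, norm_inv, norm_norm, inv_mul_cancel₀ (norm_ne_zero_iff.2 h)]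

lemma norm_lanczosVec (H : V →ₗ[ℝ] V) (g : V) (n : ℕ) :
    ‖lanczosVec H g n‖ = 1 ∨ lanczosVec H g n = 0 := by
  match n with
  | 0 => right; rfl
  | 1 => exact norm_inv_norm_smul g
  | n + 2 => exact norm_inv_norm_smul _

lemma lanczosVec_succ_eq_zero (H : V →ₗ[ℝ] V) (g : V) {n : ℕ} (hn : 1 ≤ n)
    (h : lanczosVec H g n = 0) : lanczosVec H g (n + 1) = 0 := by
  obtain ⟨n, rfl⟩ : ∃ m, n = m + 1 := ⟨n - 1, by omega⟩
  match n with
  | 0 =>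
    rw [lanczosVec_add_two, h, lanczosVec_zero]; simp
  | n + 1 =>
    -- `v_(n+2) = 0` forces the off-diagonal coefficient that divides it to vanish
    have hoff : lanczosOff H g (n + 1) = 0 := by
      rw [lanczosVec_add_two] at h
      rcases smul_eq_zero.1 h with h | h
      · exact inv_eq_zero.1 h
      · rw [lanczosOff_succ, h, norm_zero]
    rw [lanczosVec_add_two H g (n + 1), h, hoff]; simp

lemma lanczosVec_eq_zero_of_le (H : V →ₗ[ℝ] V) (g : V) {m n : ℕ} (hm : 1 ≤ m) (hmn : m ≤ n)
    (h : lanczosVec H g m = 0) : lanczosVec H g n = 0 := by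
  induction n, hmn using Nat.le_induction with
  | base => exact h
  | succ n hmn ih => exact lanczosVec_succ_eq_zero H g (hm.trans hmn) ih

lemma inner_lanczosVec_of_le {H : V →ₗ[ℝ] V} (hH : H.IsSymmetric) (g : V) (n : ℕ) :
    ∀ i j, i < j → j ≤ n → inner ℝ (lanczosVec H g i) (lanczosVec H g j) = (0 : ℝ) := by
  induction n with
  | zero => intro i j h1 h2; omega
  | succ n ih =>
    intro i j hij hj
    rcases Nat.lt_or_ge j (n + 1) with h | h
    · exact ih i j hij (by omega)
    obtain rfl : j = n + 1 := le_antisymm hj h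
    match n with
    | 0 =>
      obtain rfl : i = 0 := by omega
      rw [lanczosVec_zero, inner_zero_left]
    | n + 1 =>
      by_cases hz : lanczosVec H g (n + 1) = 0
      · rw [lanczosVec_succ_eq_zero H g (by omega) hz, inner_zero_right]
      have hnorm : inner ℝ (lanczosVec H g (n + 1)) (lanczosVec H g (n + 1)) = (1 : ℝ) := by
        rw [real_inner_self_eq_norm_sq, (norm_lanczosVec H g (n + 1)).resolve_right hz, one_pow]
      rw [lanczosVec_add_two, real_inner_smul_right, inner_sub_right, inner_sub_right,
        real_inner_smul_right, real_inner_smul_right]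
      refine mul_eq_zero_of_right _ ?_
      match i with
      | 0 => simp [lanczosVec_zero]
      | i + 1 =>
        rcases Nat.lt_or_ge (i + 1) (n + 1) with hi | hi
        · rw [ih (i + 1) (n + 1) hi le_rfl, mul_zero, sub_zero, ← hH, map_lanczosVec,
            inner_add_left, inner_add_left, real_inner_smul_left, real_inner_smul_left,
            real_inner_smul_left, ih (i + 1) (n + 1) hi le_rfl, ih i (n + 1) (by omega) le_rfl]
          rcases Nat.lt_or_ge (i + 2) (n + 1) with hi' | hi'
          · rw [ih (i + 2) (n + 1) hi' le_rfl, ih (i + 1) n (by omega) (by omega)]; ring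
          · obtain rfl : n = i + 1 := by omega
            have hz' : lanczosVec H g (i + 1) ≠ 0 := fun h =>
              hz (lanczosVec_succ_eq_zero H g (by omega) h)
            rw [hnorm, real_inner_self_eq_norm_sq, (norm_lanczosVec H g (i + 1)).resolve_right hz']
            ring
        · obtain rfl : i = n := by omega
          rw [hnorm, real_inner_comm (lanczosVec H g i) (lanczosVec H g (i + 1)),
            ih i (i + 1) (by omega) le_rfl, lanczosDiag]
          ring

lemma inner_lanczosVec {H : V →ₗ[ℝ] V} (hH : H.IsSymmetric) (g : V) {i j : ℕ} (hij : i ≠ j) :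
    inner ℝ (lanczosVec H g i) (lanczosVec H g j) = (0 : ℝ) := by
  rcases lt_or_gt_of_ne hij with h | h
  · exact inner_lanczosVec_of_le hH g j i j h le_rfl
  · rw [real_inner_comm]; exact inner_lanczosVec_of_le hH g i j i h le_rfl

/-- The span of the Lanczos vectors `v_1, …, v_n`. -/
def lanczosSpan (H : V →ₗ[ℝ] V) (g : V) (n : ℕ) : Submodule ℝ V :=
  Submodule.span ℝ (Set.range fun j : Fin n => lanczosVec H g (j + 1))

lemma lanczosVec_mem_span (H : V →ₗ[ℝ] V) (g : V) {j n : ℕ} (h : j ≤ n) :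
    lanczosVec H g j ∈ lanczosSpan H g n := by
  match j with
  | 0 => rw [lanczosVec_zero]; exact zero_mem _
  | j + 1 => exact Submodule.subset_span ⟨⟨j, h⟩, rfl⟩

lemma map_mem_lanczosSpan (H : V →ₗ[ℝ] V) (g : V) {n : ℕ} {y : V}
    (hy : y ∈ lanczosSpan H g n) : H y ∈ lanczosSpan H g (n + 1) := by
  have : lanczosSpan H g n ≤ (lanczosSpan H g (n + 1)).comap H := by
    refine Submodule.span_le.2 ?_
    rintro _ ⟨j, rfl⟩
    have hj := j.2
    show H _ ∈ lanczosSpan H g (n + 1)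
    rw [map_lanczosVec]
    exact add_mem (add_mem (Submodule.smul_mem _ _ (lanczosVec_mem_span H g (by omega)))
      (Submodule.smul_mem _ _ (lanczosVec_mem_span H g (by omega))))
      (Submodule.smul_mem _ _ (lanczosVec_mem_span H g (by omega)))
  exact this hy

lemma lanczosSpan_mono (H : V →ₗ[ℝ] V) (g : V) {m n : ℕ} (h : m ≤ n) :
    lanczosSpan H g m ≤ lanczosSpan H g n := by
  refine Submodule.span_le.2 ?_
  rintro _ ⟨j, rfl⟩
  exact lanczosVec_mem_span H g (by omega)

lemma krylov_le_lanczosSpan (H : V →ₗ[ℝ] V) (g : V) (n : ℕ) :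
    krylov H g n ≤ lanczosSpan H g n := by
  have hg : ∀ j : ℕ, (H ^ j) g ∈ lanczosSpan H g (j + 1) := by
    intro j
    induction j with
    | zero =>
      by_cases h : g = 0
      · simp [h]
      · have : (H ^ 0) g = ‖g‖ • lanczosVec H g 1 := by
          rw [lanczosVec_one, smul_smul, mul_inv_cancel₀ (norm_ne_zero_iff.2 h)]; simp
        rw [this]
        exact Submodule.smul_mem _ _ (lanczosVec_mem_span H g le_rfl)
    | succ j ih =>
      rw [pow_succ']
      exact map_mem_lanczosSpan H g ih
  refine Submodule.span_le.2 ?_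
  rintro _ ⟨j, rfl⟩
  exact lanczosSpan_mono H g j.2 (hg j)

lemma lanczosT_eq_inner {H : V →ₗ[ℝ] V} (hH : H.IsSymmetric) (g : V) {m : ℕ}
    (hm : lanczosVec H g m ≠ 0) (i j : Fin m) :
    lanczosT H g m i j = inner ℝ (lanczosVec H g (i + 1)) (H (lanczosVec H g (j + 1))) := by
  have hnorm : ∀ k : ℕ, 1 ≤ k → k ≤ m → inner ℝ (lanczosVec H g k) (lanczosVec H g k) = (1 : ℝ) := by
    intro k hk hkm
    have hz : lanczosVec H g k ≠ 0 := fun h => hm (lanczosVec_eq_zero_of_le H g hk hkm h)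
    rw [real_inner_self_eq_norm_sq, (norm_lanczosVec H g k).resolve_right hz, one_pow]
  have hi := i.2
  have hj := j.2
  rw [lanczosT, Matrix.of_apply]
  split_ifs with h1 h2 h3
  · rw [h1, lanczosDiag]
  · rw [← hH, map_lanczosVec, inner_add_left, inner_add_left, real_inner_smul_left,
      real_inner_smul_left, real_inner_smul_left, ← h2, hnorm _ (by omega) (by omega),
      inner_lanczosVec hH g (by omega), inner_lanczosVec hH g (by omega)]
    ring
  · rw [map_lanczosVec, inner_add_right, inner_add_right, real_inner_smul_right,
      real_inner_smul_right, real_inner_smul_right, ← h3, hnorm _ (by omega) (by omega),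
      inner_lanczosVec hH g (by omega), inner_lanczosVec hH g (by omega)]
    ring
  · have h1' : (i : ℕ) ≠ j := fun h => h1 (Fin.ext h)
    rw [map_lanczosVec, inner_add_right, inner_add_right, real_inner_smul_right,
      real_inner_smul_right, real_inner_smul_right, inner_lanczosVec hH g (by omega),
      inner_lanczosVec hH g (by omega), inner_lanczosVec hH g (by omega)]
    ring

/-- `T_m ⪰ σ I` says that the quadratic form of `H` is at least `σ ‖·‖²` on the Krylov space. -/
lemma LanczosBoundedBelow.le_inner {H : V →ₗ[ℝ] V} (hH : H.IsSymmetric) {g : V} {t : ℕ} {σ : ℝ}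
    (h : LanczosBoundedBelow H g t σ) {y : V} (hy : y ∈ krylov H g t) :
    σ * ‖y‖ ^ 2 ≤ inner ℝ y (H y) := by
  -- `m` is the last step that the process performs up to step `t`
  obtain ⟨m, hmt, hm, hspan⟩ : ∃ m ≤ t, (lanczosVec H g m ≠ 0 ∨ m = 0) ∧
      lanczosSpan H g t ≤ lanczosSpan H g m := by
    clear h hy
    induction t with
    | zero => exact ⟨0, le_rfl, Or.inr rfl, le_rfl⟩
    | succ t ih =>
      by_cases hz : lanczosVec H g (t + 1) = 0
      · obtain ⟨m, hmt, hm, hs⟩ := ih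
        refine ⟨m, hmt.trans t.le_succ, hm, le_trans ?_ hs⟩
        refine Submodule.span_le.2 ?_
        rintro _ ⟨j, rfl⟩
        rcases Nat.lt_or_ge j t with hj | hj
        · exact lanczosVec_mem_span H g hj
        · have : (j : ℕ) = t := by omega
          simp only [this, hz]
          exact zero_mem _
      · exact ⟨t + 1, le_rfl, Or.inl hz, le_rfl⟩
  have hy' := hspan (krylov_le_lanczosSpan H g t hy)
  rcases hm with hm | rfl
  swap
  · have : y = 0 := by simpa [lanczosSpan] using hy'
    simp [this]
  obtain ⟨c, rfl⟩ := (Submodule.mem_span_range_iff_exists_fun ℝ).1 hy'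
  have hps := (h m hmt hm).dotProduct_mulVec_nonneg c
  have e1 : ‖∑ i : Fin m, c i • lanczosVec H g (i + 1)‖ ^ 2 = ∑ i, c i * c i := by
    rw [← real_inner_self_eq_norm_sq, sum_inner]
    refine Finset.sum_congr rfl fun i _ => ?_
    rw [inner_sum, Finset.sum_eq_single i]
    · have hz : lanczosVec H g (i + 1) ≠ 0 := fun h =>
        hm (lanczosVec_eq_zero_of_le H g (by omega) i.2 h)
      rw [real_inner_smul_left, real_inner_smul_right, real_inner_self_eq_norm_sq,
        (norm_lanczosVec H g _).resolve_right hz]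
      ring
    · intro j _ hj
      have : (j : ℕ) ≠ i := fun h => hj (Fin.ext h)
      rw [real_inner_smul_left, real_inner_smul_right, inner_lanczosVec hH g (by omega)]
      ring
    · simp
  have e2 : inner ℝ (∑ i : Fin m, c i • lanczosVec H g (i + 1))
      (H (∑ i : Fin m, c i • lanczosVec H g (i + 1)))
      = ∑ i, c i * ∑ j, lanczosT H g m i j * c j := by
    rw [map_sum, sum_inner]
    refine Finset.sum_congr rfl fun i _ => ?_
    rw [inner_sum, Finset.mul_sum]
    refine Finset.sum_congr rfl fun j _ => ?_
    rw [map_smul, real_inner_smul_left, real_inner_smul_right, lanczosT_eq_inner hH g hm]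
    ring
  have e3 : star c ⬝ᵥ ((lanczosT H g m - σ • (1 : Matrix (Fin m) (Fin m) ℝ)).mulVec c)
      = (∑ i, c i * ∑ j, lanczosT H g m i j * c j) - σ * ∑ i, c i * c i := by
    rw [Matrix.sub_mulVec, Matrix.smul_mulVec, Matrix.one_mulVec, dotProduct_sub, dotProduct_smul]
    simp [dotProduct, Matrix.mulVec]
  rw [e3] at hps
  rw [e1, e2]
  linarith

/-- A SOL step of regularity `σ` has curvature at least `σ`, descends at least at the rate of its
curvature, and its residual is small relative to `η ‖H p‖`. -/
lemma MinresReturns.sol_regular {H : V →ₗ[ℝ] V} (hH : H.IsSymmetric) {g : V} {η σ : ℝ}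
    (hη : 0 ≤ η) {t : ℕ} {p : V} (h : MinresReturns H g η 0 t p DType.SOL)
    (hT : LanczosBoundedBelow H g t σ) :
    inner ℝ g p ≤ -inner ℝ p (H p) ∧ σ * ‖p‖ ^ 2 ≤ inner ℝ p (H p) ∧
      σ * ‖H p + g‖ ≤ η * ‖H p‖ := by
  obtain ⟨h1, h2, h3, h4⟩ := h.sol_spec hH hη
  refine ⟨h1, hT.le_inner hH h3, ?_⟩
  have e : ‖minresResidual H g p‖ = ‖H p + g‖ := by
    rw [← norm_neg, minresResidual]; congr 1; abel
  rw [← e]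
  set r := minresResidual H g p
  refine le_trans ?_ h2
  rcases (norm_nonneg r).eq_or_lt with h0 | h0
  · rw [← h0, mul_zero]; exact norm_nonneg _
  · have h5 := (hT.le_inner hH h4).trans (real_inner_le_norm r (H r))
    refine le_of_mul_le_mul_left ?_ h0
    calc ‖r‖ * (σ * ‖r‖) = σ * ‖r‖ ^ 2 := by ring
      _ ≤ _ := h5

end Lanczos

/-! ### Taylor estimates on the orthant -/

section Calculus

variable {d : ℕ} {f : EuclideanSpace ℝ (Fin d) → ℝ}

lemma convex_orthant : Convex ℝ (orthant d) := by
  intro x hx y hy a b ha hb _ i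
  simpa using add_nonneg (mul_nonneg ha (hx i)) (mul_nonneg hb (hy i))

lemma hasFDerivAt_toDual_gradient (hf : ContDiff ℝ 2 f) (x : EuclideanSpace ℝ (Fin d)) :
    HasFDerivAt f (InnerProductSpace.toDual ℝ _ (gradient f x)) x := by
  rw [toDual_gradient]
  exact (hf.differentiable (by norm_num) x).hasFDerivAt

lemma hasFDerivAt_gradient (hf : ContDiff ℝ 2 f) (x : EuclideanSpace ℝ (Fin d)) :
    HasFDerivAt (gradient f) (hess f x) x := by
  have h1 : ContDiff ℝ 1 (fderiv ℝ f) := hf.fderiv_right (by norm_num)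
  have h2 : Differentiable ℝ (gradient f) := by
    have : gradient f = fun y => (InnerProductSpace.toDual ℝ _).symm (fderiv ℝ f y) := rfl
    rw [this]
    exact (InnerProductSpace.toDual ℝ (EuclideanSpace ℝ (Fin d))).symm.toContinuousLinearEquiv.differentiable.comp
      (h1.differentiable (by norm_num))
  exact (h2 x).hasFDerivAt

lemma inner_hess_comm (hf : ContDiff ℝ 2 f) (x u v : EuclideanSpace ℝ (Fin d)) :
    inner ℝ (hess f x u) v = inner ℝ u (hess f x v) := by
  have hsymm : IsSymmSndFDerivAt ℝ f x :=
    hf.contDiffAt.isSymmSndFDerivAt (by simp)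
  have h1 : HasFDerivAt (fderiv ℝ f)
      ((InnerProductSpace.toDual ℝ (EuclideanSpace ℝ (Fin d))).toContinuousLinearEquiv.toContinuousLinearMap.comp
        (hess f x)) x := by
    have h := (InnerProductSpace.toDual ℝ (EuclideanSpace ℝ (Fin d))).toContinuousLinearEquiv.toContinuousLinearMap.hasFDerivAt.comp x
      (hasFDerivAt_gradient hf x)
    have e : fderiv ℝ f = fun y => InnerProductSpace.toDual ℝ _ (gradient f y) := by
      funext y; rw [toDual_gradient]
    rw [e]
    exact h
  have h2 : ∀ a b, fderiv ℝ (fderiv ℝ f) x a b = inner ℝ (hess f x a) b := by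
    intro a b
    rw [h1.fderiv]
    simp
  rw [← h2, hsymm.eq u v, h2, real_inner_comm]

lemma le_taylor_one (hf : ContDiff ℝ 2 f) {L : ℝ} (hL : 0 ≤ L)
    (hg : ∀ x ∈ orthant d, ∀ y ∈ orthant d, ‖gradient f x - gradient f y‖ ≤ L * ‖x - y‖)
    {x y : EuclideanSpace ℝ (Fin d)} (hx : x ∈ orthant d) (hy : y ∈ orthant d) :
    f y ≤ f x + inner ℝ (gradient f x) (y - x) + L * ‖y - x‖ ^ 2 := by
  have h := (convex_segment x y).norm_image_sub_le_of_norm_hasFDerivWithin_le' (f := f)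
    (φ := InnerProductSpace.toDual ℝ _ (gradient f x)) (C := L * ‖y - x‖)
    (fun z _ => (hasFDerivAt_toDual_gradient hf z).hasFDerivWithinAt)
    (fun z hz => by
      rw [← map_sub, LinearIsometryEquiv.norm_map]
      refine (hg z (convex_orthant.segment_subset hx hy hz) x hx).trans ?_
      exact mul_le_mul_of_nonneg_left (norm_sub_le_of_mem_segment hz) hL)
    (left_mem_segment ℝ x y) (right_mem_segment ℝ x y)
  rw [InnerProductSpace.toDual_apply_apply] at h
  have := (le_abs_self _).trans h
  nlinarith

lemma gradient_taylor (hf : ContDiff ℝ 2 f) {L : ℝ} (hL : 0 ≤ L)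
    (hH : ∀ x ∈ orthant d, ∀ y ∈ orthant d, ‖hess f x - hess f y‖ ≤ L * ‖x - y‖)
    {x y : EuclideanSpace ℝ (Fin d)} (hx : x ∈ orthant d) (hy : y ∈ orthant d) :
    ‖gradient f y - gradient f x - hess f x (y - x)‖ ≤ L * ‖y - x‖ ^ 2 := by
  have h := (convex_segment x y).norm_image_sub_le_of_norm_hasFDerivWithin_le' (f := gradient f)
    (φ := hess f x) (C := L * ‖y - x‖)
    (fun z _ => (hasFDerivAt_gradient hf z).hasFDerivWithinAt)
    (fun z hz => (hH z (convex_orthant.segment_subset hx hy hz) x hx).trans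
      (mul_le_mul_of_nonneg_left (norm_sub_le_of_mem_segment hz) hL))
    (left_mem_segment ℝ x y) (right_mem_segment ℝ x y)
  rwa [mul_assoc, ← sq] at h

lemma le_taylor_two (hf : ContDiff ℝ 2 f) {L : ℝ} (hL : 0 ≤ L)
    (hH : ∀ x ∈ orthant d, ∀ y ∈ orthant d, ‖hess f x - hess f y‖ ≤ L * ‖x - y‖)
    {x y : EuclideanSpace ℝ (Fin d)} (hx : x ∈ orthant d) (hy : y ∈ orthant d) :
    f y ≤ f x + inner ℝ (gradient f x) (y - x) + inner ℝ (y - x) (hess f x (y - x)) / 2 +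
      L * ‖y - x‖ ^ 3 := by
  set ψ : EuclideanSpace ℝ (Fin d) → ℝ := fun z =>
    f z - (1 / 2) * inner ℝ (z - x) (hess f x (z - x)) with hψ
  have hd : ∀ z, HasFDerivAt ψ
      (InnerProductSpace.toDual ℝ _ (gradient f z - hess f x (z - x))) z := by
    intro z
    have h1 : HasFDerivAt (fun z => z - x)
        (ContinuousLinearMap.id ℝ (EuclideanSpace ℝ (Fin d))) z :=
      (hasFDerivAt_id z).sub_const x
    have h2 := h1.inner ℝ ((hess f x).hasFDerivAt.comp z h1)
    refine ((hasFDerivAt_toDual_gradient hf z).sub (h2.const_mul (1 / 2))).congr_fderiv ?_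
    ext v
    simp [InnerProductSpace.toDual_apply_apply, inner_sub_left]
    rw [← map_sub, ← inner_sub_left, ← inner_hess_comm hf, ← inner_sub_left, ← map_sub,
      real_inner_comm (hess f x (z - x)) v]
    ring
  have h := (convex_segment x y).norm_image_sub_le_of_norm_hasFDerivWithin_le' (f := ψ)
    (φ := InnerProductSpace.toDual ℝ _ (gradient f x)) (C := L * ‖y - x‖ ^ 2)
    (fun z _ => (hd z).hasFDerivWithinAt)
    (fun z hz => by
      rw [← map_sub, LinearIsometryEquiv.norm_map, sub_right_comm]
      refine (gradient_taylor hf hL hH hx (convex_orthant.segment_subset hx hy hz)).trans ?_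
      refine mul_le_mul_of_nonneg_left ?_ hL
      exact pow_le_pow_left₀ (norm_nonneg _) (norm_sub_le_of_mem_segment hz) 2)
    (left_mem_segment ℝ x y) (right_mem_segment ℝ x y)
  have h' := (le_abs_self _).trans h
  simp only [hψ, InnerProductSpace.toDual_apply_apply, sub_self, map_zero, inner_zero_left,
    mul_zero, sub_zero] at h'
  nlinarith

/-- Along directions that stay in the orthant on both sides, the Lipschitz constant of the gradient
bounds the Hessian. -/
lemma norm_hess_apply_le (hf : ContDiff ℝ 2 f) {L : ℝ} (hL : 0 ≤ L)
    (hg : ∀ x ∈ orthant d, ∀ y ∈ orthant d, ‖gradient f x - gradient f y‖ ≤ L * ‖x - y‖)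
    {x v : EuclideanSpace ℝ (Fin d)} (hx : x ∈ orthant d)
    (hv : ∀ᶠ t : ℝ in nhds 0, x + t • v ∈ orthant d) : ‖hess f x v‖ ≤ L * ‖v‖ := by
  have h1 : HasDerivAt (fun t : ℝ => x + t • v) v 0 := by
    simpa using ((hasDerivAt_id (0 : ℝ)).smul_const v).const_add x
  have h2 : HasDerivAt (fun t : ℝ => gradient f (x + t • v)) (hess f x v) 0 := by
    have h3 : HasFDerivAt (gradient f) (hess f x) (x + (0 : ℝ) • v) := by
      simpa using hasFDerivAt_gradient hf x
    exact h3.comp_hasDerivAt 0 h1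
  refine h2.le_of_lip' (by positivity) ?_
  filter_upwards [hv] with t ht
  have := hg _ ht x hx
  simpa [norm_smul, mul_comm, mul_assoc, mul_left_comm] using this

end Calculus

/-! ### Subvectors, zero extension and the projected step -/

section Blocks

variable {d : ℕ} {f : EuclideanSpace ℝ (Fin d) → ℝ}

/-- Extension by zero of a vector indexed by `J`; the adjoint of `subvec J`. -/
noncomputable def zeroExt (J : Finset (Fin d)) (q : EuclideanSpace ℝ J) :
    EuclideanSpace ℝ (Fin d) :=
  WithLp.toLp 2 fun i => if h : i ∈ J then q ⟨i, h⟩ else 0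

lemma zeroExt_apply_mem {J : Finset (Fin d)} (q : EuclideanSpace ℝ J) {i : Fin d} (h : i ∈ J) :
    zeroExt J q i = q ⟨i, h⟩ := by simp [zeroExt, h]

lemma zeroExt_apply_notMem {J : Finset (Fin d)} (q : EuclideanSpace ℝ J) {i : Fin d} (h : i ∉ J) :
    zeroExt J q i = 0 := by simp [zeroExt, h]

lemma inner_eq_sum (u v : EuclideanSpace ℝ (Fin d)) : inner ℝ u v = ∑ i, u i * v i := by
  simp [PiLp.inner_apply, mul_comm]

lemma inner_subvec (J : Finset (Fin d)) (v : EuclideanSpace ℝ (Fin d)) (q : EuclideanSpace ℝ J) :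
    inner ℝ (subvec J v) q = ∑ i ∈ J, v i * zeroExt J q i := by
  rw [← Finset.sum_attach]
  simp [PiLp.inner_apply, subvec, mul_comm, zeroExt]

lemma inner_zeroExt (J : Finset (Fin d)) (v : EuclideanSpace ℝ (Fin d)) (q : EuclideanSpace ℝ J) :
    inner ℝ v (zeroExt J q) = inner ℝ (subvec J v) q := by
  rw [inner_subvec, inner_eq_sum]
  refine (Finset.sum_subset (Finset.subset_univ J) fun i _ hi => ?_).symm
  rw [zeroExt_apply_notMem q hi, mul_zero]

lemma subvec_zeroExt (J : Finset (Fin d)) (q : EuclideanSpace ℝ J) :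
    subvec J (zeroExt J q) = q := by
  ext i
  simp [subvec, zeroExt]

lemma norm_zeroExt (J : Finset (Fin d)) (q : EuclideanSpace ℝ J) : ‖zeroExt J q‖ = ‖q‖ := by
  have h := inner_zeroExt J (zeroExt J q) q
  rw [subvec_zeroExt, real_inner_self_eq_norm_sq, real_inner_self_eq_norm_sq] at h
  exact (sq_eq_sq₀ (norm_nonneg _) (norm_nonneg _)).1 h

lemma norm_subvec_sq (J : Finset (Fin d)) (v : EuclideanSpace ℝ (Fin d)) :
    ‖subvec J v‖ ^ 2 = ∑ i ∈ J, v i ^ 2 := by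
  rw [EuclideanSpace.real_norm_sq_eq]
  exact Finset.sum_coe_sort J fun i => v i ^ 2

lemma norm_subvec_mono {J J' : Finset (Fin d)} (h : J' ⊆ J) (v : EuclideanSpace ℝ (Fin d)) :
    ‖subvec J' v‖ ≤ ‖subvec J v‖ := by
  refine (sq_le_sq₀ (norm_nonneg _) (norm_nonneg _)).1 ?_
  rw [norm_subvec_sq, norm_subvec_sq]
  exact Finset.sum_le_sum_of_subset_of_nonneg h fun _ _ _ => sq_nonneg _

lemma norm_subvec_le (J : Finset (Fin d)) (v : EuclideanSpace ℝ (Fin d)) :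
    ‖subvec J v‖ ≤ ‖v‖ := by
  refine (sq_le_sq₀ (norm_nonneg _) (norm_nonneg _)).1 ?_
  rw [norm_subvec_sq, EuclideanSpace.real_norm_sq_eq]
  exact Finset.sum_le_sum_of_subset_of_nonneg (Finset.subset_univ J) fun _ _ _ => sq_nonneg _

lemma subHess_apply (J : Finset (Fin d)) (x : EuclideanSpace ℝ (Fin d)) (q : EuclideanSpace ℝ J) :
    subHess f J x q = subvec J (hess f x (zeroExt J q)) := by
  have hq : zeroExt J q = ∑ j : J, q j • EuclideanSpace.single (j : Fin d) (1 : ℝ) := by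
    ext i
    simp only [WithLp.ofLp_sum, WithLp.ofLp_smul, Finset.sum_apply, Pi.smul_apply, smul_eq_mul,
      PiLp.single_apply, mul_ite, mul_one, mul_zero]
    by_cases h : i ∈ J
    · rw [zeroExt_apply_mem q h, Finset.sum_eq_single (⟨i, h⟩ : J)]
      · simp
      · intro j _ hj
        rw [if_neg]
        rintro rfl
        exact hj rfl
      · simp
    · rw [zeroExt_apply_notMem q h]
      refine (Finset.sum_eq_zero fun j _ => if_neg ?_).symm
      rintro rfl
      exact h j.2
  rw [hq, map_sum]
  ext i
  simp [subHess, subHessMatrix, Matrix.mulVec, dotProduct, subvec, mul_comm]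

lemma inner_subHess (J : Finset (Fin d)) (x : EuclideanSpace ℝ (Fin d)) (p q : EuclideanSpace ℝ J) :
    inner ℝ p (subHess f J x q) = inner ℝ (zeroExt J p) (hess f x (zeroExt J q)) := by
  rw [subHess_apply, real_inner_comm, ← inner_zeroExt, real_inner_comm]

lemma subHess_isSymmetric (hf : ContDiff ℝ 2 f) (J : Finset (Fin d))
    (x : EuclideanSpace ℝ (Fin d)) : (subHess f J x).IsSymmetric := by
  intro p q
  rw [real_inner_comm, inner_subHess, inner_subHess, real_inner_comm, inner_hess_comm hf]

lemma proj_mem_orthant (x : EuclideanSpace ℝ (Fin d)) : proj x ∈ orthant d :=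
  fun _ => le_max_right _ _

lemma proj_of_mem {x : EuclideanSpace ℝ (Fin d)} (hx : x ∈ orthant d) : proj x = x := by
  ext i
  exact max_eq_left (hx i)

lemma mem_activeSet_iff {x : EuclideanSpace ℝ (Fin d)} (hx : x ∈ orthant d) {δ : ℝ} {i : Fin d} :
    i ∈ activeSet x δ ↔ i ∉ inactiveSet x δ := by
  simp [activeSet, inactiveSet, hx i]

lemma sum_activeSet_add_sum_inactiveSet {x : EuclideanSpace ℝ (Fin d)} (hx : x ∈ orthant d) (δ : ℝ)
    (φ : Fin d → ℝ) :
    ∑ i ∈ activeSet x δ, φ i + ∑ i ∈ inactiveSet x δ, φ i = ∑ i, φ i := by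
  have : activeSet x δ = (inactiveSet x δ)ᶜ := by
    ext i; rw [mem_activeSet_iff hx, Finset.mem_compl]
  rw [this]
  exact Finset.sum_compl_add_sum _ _

lemma direction_apply_mem (x : EuclideanSpace ℝ (Fin d)) (δ : ℝ) (F : StepType)
    (q : EuclideanSpace ℝ (inactiveSet x δ)) {i : Fin d} (h : i ∈ inactiveSet x δ) :
    direction f δ x F q i = zeroExt _ q i := by
  simp [direction, zeroExt, h]

lemma direction_typeII (x : EuclideanSpace ℝ (Fin d)) (δ : ℝ)
    (q : EuclideanSpace ℝ (inactiveSet x δ)) :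
    direction f δ x StepType.typeII q = zeroExt _ q := rfl

lemma direction_typeI_apply (x : EuclideanSpace ℝ (Fin d)) (δ : ℝ)
    (q : EuclideanSpace ℝ (inactiveSet x δ)) {i : Fin d} (h : i ∉ inactiveSet x δ) :
    direction f δ x StepType.typeI q i = -gradient f x i := by
  simp [direction, h]

/-- The linear part of the line search criterion on the inactive block. -/
lemma sum_inactive_direction (x : EuclideanSpace ℝ (Fin d)) (δ : ℝ) (F : StepType)
    (q : EuclideanSpace ℝ (inactiveSet x δ)) :
    ∑ i ∈ inactiveSet x δ, gradient f x i * direction f δ x F q i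
      = inner ℝ (subvec (inactiveSet x δ) (gradient f x)) q := by
  rw [inner_subvec]
  exact Finset.sum_congr rfl fun i hi => by rw [direction_apply_mem x δ F q hi]

/-- A step of inactive length at most `δ` keeps the inactive components positive. -/
lemma zero_le_add_zeroExt {x : EuclideanSpace ℝ (Fin d)} {δ α : ℝ}
    (hα : 0 ≤ α) {q : EuclideanSpace ℝ (inactiveSet x δ)} (hq : α * ‖q‖ ≤ δ) {i : Fin d}
    (hi : i ∈ inactiveSet x δ) : 0 ≤ x i + α * zeroExt _ q i := by
  have h1 : |zeroExt _ q i| ≤ ‖q‖ := by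
    rw [← norm_zeroExt, ← Real.norm_eq_abs]; exact PiLp.norm_apply_le _ _
  have h2 : δ < x i := by simpa [inactiveSet] using hi
  have h3 := mul_le_mul_of_nonneg_left ((neg_le_abs _).trans h1) hα
  linarith

lemma add_smul_zeroExt_mem_orthant {x : EuclideanSpace ℝ (Fin d)} (hx : x ∈ orthant d) {δ α : ℝ}
    (hα : 0 ≤ α) {q : EuclideanSpace ℝ (inactiveSet x δ)} (hq : α * ‖q‖ ≤ δ) :
    x + α • zeroExt _ q ∈ orthant d := by
  intro i
  by_cases hi : i ∈ inactiveSet x δ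
  · exact zero_le_add_zeroExt hα hq hi
  · simpa [zeroExt_apply_notMem q hi] using hx i

/-- The displacement of the projected step from `x`. -/
noncomputable def disp (x p : EuclideanSpace ℝ (Fin d)) (α : ℝ) : EuclideanSpace ℝ (Fin d) :=
  proj (x + α • p) - x

lemma disp_apply (x p : EuclideanSpace ℝ (Fin d)) (α : ℝ) (i : Fin d) :
    disp x p α i = max (x i + α * p i) 0 - x i := rfl

lemma disp_inactive {x : EuclideanSpace ℝ (Fin d)} {δ α : ℝ} (hα : 0 ≤ α) (F : StepType)
    {q : EuclideanSpace ℝ (inactiveSet x δ)} (hq : α * ‖q‖ ≤ δ) {i : Fin d}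
    (hi : i ∈ inactiveSet x δ) : disp x (direction f δ x F q) α i = α * zeroExt _ q i := by
  rw [disp_apply, direction_apply_mem x δ F q hi, max_eq_left (zero_le_add_zeroExt hα hq hi)]
  ring

/-- On the active block, the projected step satisfies the projection inequality. -/
lemma disp_active_sq_le {x : EuclideanSpace ℝ (Fin d)} (hx : x ∈ orthant d) {δ α : ℝ} (F : StepType) (q : EuclideanSpace ℝ (inactiveSet x δ)) {i : Fin d}
    (hi : i ∉ inactiveSet x δ) :
    disp x (direction f δ x F q) α i ^ 2
      ≤ -(α * (gradient f x i * disp x (direction f δ x F q) α i)) := by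
  have hxi := hx i
  cases F with
  | typeI =>
    rw [disp_apply, direction_typeI_apply x δ q hi]
    rcases le_total 0 (x i + α * -gradient f x i) with h | h
    · rw [max_eq_left h]
      nlinarith
    · rw [max_eq_right h]
      nlinarith
  | typeII =>
    rw [disp_apply, direction_typeII, zeroExt_apply_notMem q hi, mul_zero, add_zero,
      max_eq_left hxi]
    simp

lemma gradient_mul_disp_active_nonpos {x : EuclideanSpace ℝ (Fin d)} (hx : x ∈ orthant d) {δ α : ℝ}
    (hα : 0 < α) (F : StepType) (q : EuclideanSpace ℝ (inactiveSet x δ)) {i : Fin d}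
    (hi : i ∉ inactiveSet x δ) :
    gradient f x i * disp x (direction f δ x F q) α i ≤ 0 := by
  have := disp_active_sq_le (f := f) (α := α) hx F q hi
  nlinarith [sq_nonneg (disp x (direction f δ x F q) α i)]

lemma norm_subHess_apply_le (hf : ContDiff ℝ 2 f) {L : ℝ} (hL : 0 ≤ L)
    (hg : ∀ x ∈ orthant d, ∀ y ∈ orthant d, ‖gradient f x - gradient f y‖ ≤ L * ‖x - y‖)
    {x : EuclideanSpace ℝ (Fin d)} (hx : x ∈ orthant d) {δ : ℝ} (hδ : 0 < δ)
    (q : EuclideanSpace ℝ (inactiveSet x δ)) :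
    ‖subHess f (inactiveSet x δ) x q‖ ≤ L * ‖q‖ := by
  rw [subHess_apply]
  refine (norm_subvec_le _ _).trans ?_
  rw [← norm_zeroExt _ q]
  refine norm_hess_apply_le hf hL hg hx ?_
  have hc : Filter.Tendsto (fun t : ℝ => |t| * ‖q‖) (nhds 0) (nhds 0) := by
    have : Continuous fun t : ℝ => |t| * ‖q‖ := by fun_prop
    simpa using this.tendsto 0
  filter_upwards [hc.eventually_lt_const hδ] with t ht
  rcases le_total 0 t with h0 | h0
  · rw [abs_of_nonneg h0] at ht
    exact add_smul_zeroExt_mem_orthant hx h0 ht.le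
  · rw [abs_of_nonpos h0] at ht
    have e : t • zeroExt _ q = (-t) • zeroExt _ (-q) := by
      have : zeroExt _ (-q) = -zeroExt _ q := by
        ext i
        by_cases hi : i ∈ inactiveSet x δ
        · simp [zeroExt_apply_mem _ hi]
        · simp [zeroExt_apply_notMem _ hi]
      rw [this, smul_neg, neg_smul, neg_neg]
    rw [e]
    exact add_smul_zeroExt_mem_orthant hx (by linarith) (by rw [norm_neg]; exact ht.le)

end Blocks

/-! ### Step sizes that satisfy the line search criterion -/

section LineSearch

lemma exists_backtrackReturns {crit : ℝ → Prop} {ζ : ℝ} (hζ : 0 < ζ) (hζ' : ζ < 1)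
    (h : ∃ a > 0, ∀ α, 0 < α → α ≤ a → crit α) : ∃ α, BacktrackReturns crit ζ 1 α := by
  classical
  obtain ⟨a, ha, hcrit⟩ := h
  have hex : ∃ n : ℕ, crit (ζ ^ n * 1) := by
    obtain ⟨n, hn⟩ := exists_pow_lt_of_lt_one ha hζ'
    exact ⟨n, hcrit _ (by positivity) (by rw [mul_one]; exact hn.le)⟩
  exact ⟨_, Nat.find hex, rfl, Nat.find_spec hex, fun m hm => Nat.find_min hex hm⟩

lemma exists_forwardReturns {crit : ℝ → Prop} {ζ : ℝ} (hζ : 0 < ζ) (hζ' : ζ < 1)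
    (h : ∃ a > 0, ∀ α, 0 < α → α ≤ a → crit α) (h' : ∃ b, ∀ α, b ≤ α → ¬ crit α) :
    ∃ α, ForwardReturns crit ζ 1 α := by
  classical
  by_cases h1 : crit 1
  · obtain ⟨b, hb⟩ := h'
    have hex : ∃ n : ℕ, ¬ crit (1 / ζ ^ n) := by
      obtain ⟨n, hn⟩ := pow_unbounded_of_one_lt b ((one_lt_inv₀ hζ).2 hζ')
      exact ⟨n, hb _ (by rw [one_div, ← inv_pow]; exact hn.le)⟩
    exact ⟨_, Or.inr ⟨h1, Nat.find hex, Nat.find_spec hex,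
      fun m hm => not_not.1 (Nat.find_min hex hm), rfl⟩⟩
  · obtain ⟨α, hα⟩ := exists_backtrackReturns hζ hζ' h
    exact ⟨α, Or.inl ⟨h1, hα⟩⟩

/-- Unless the first trial step size is accepted, the one tried before the result was rejected. -/
lemma BacktrackReturns.spec {crit : ℝ → Prop} {ζ α : ℝ} (hζ : 0 < ζ) (hζ' : ζ < 1)
    (h : BacktrackReturns crit ζ 1 α) :
    crit α ∧ 0 < α ∧ (α = 1 ∨ (α / ζ ≤ 1 ∧ ¬ crit (α / ζ))) := by
  obtain ⟨n, rfl, hc, hn⟩ := h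
  refine ⟨hc, by positivity, ?_⟩
  cases n with
  | zero => left; simp
  | succ n =>
    right
    have e : ζ ^ (n + 1) * 1 / ζ = ζ ^ n * 1 := by field_simp; ring
    rw [e]
    exact ⟨by rw [mul_one]; exact pow_le_one₀ hζ.le hζ'.le, hn n n.lt_succ_self⟩

/-- Both branches of the forward/backward search stop next to a rejected step size, so the result
needs no cap at `1`. -/
lemma ForwardReturns.spec {crit : ℝ → Prop} {ζ α : ℝ} (hζ : 0 < ζ) (hζ' : ζ < 1)
    (h : ForwardReturns crit ζ 1 α) : crit α ∧ 0 < α ∧ ¬ crit (α / ζ) := by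
  rcases h with ⟨h1, h⟩ | ⟨h1, n, hn, hlt, rfl⟩
  · obtain ⟨hc, hpos, h⟩ := h.spec hζ hζ'
    refine ⟨hc, hpos, ?_⟩
    rcases h with rfl | h
    · exact absurd hc h1
    · exact h.2
  · cases n with
    | zero => exact absurd h1 (by simpa using hn)
    | succ n =>
      have e : ζ * (1 / ζ ^ (n + 1)) = 1 / ζ ^ n := by field_simp; ring
      have e' : ζ * (1 / ζ ^ (n + 1)) / ζ = 1 / ζ ^ (n + 1) := by field_simp
      rw [e', e]
      exact ⟨hlt n n.lt_succ_self, by positivity, hn⟩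

end LineSearch

section Criterion

variable {d : ℕ} {f : EuclideanSpace ℝ (Fin d) → ℝ}

lemma lineSearchCriterion_iff {ρ δ α : ℝ} {x : EuclideanSpace ℝ (Fin d)} {F : StepType}
    {q : EuclideanSpace ℝ (inactiveSet x δ)} :
    LineSearchCriterion f ρ δ x (direction f δ x F q) α ↔
      f (proj (x + α • direction f δ x F q)) - f x ≤
        ρ * (∑ i ∈ activeSet x δ, gradient f x i * disp x (direction f δ x F q) α i) +
          α * ρ * inner ℝ (subvec (inactiveSet x δ) (gradient f x)) q := by
  rw [LineSearchCriterion, sum_inactive_direction]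
  rfl

lemma sum_active_disp_nonpos {x : EuclideanSpace ℝ (Fin d)} (hx : x ∈ orthant d) {δ α : ℝ}
    (hα : 0 < α) (F : StepType) (q : EuclideanSpace ℝ (inactiveSet x δ)) :
    ∑ i ∈ activeSet x δ, gradient f x i * disp x (direction f δ x F q) α i ≤ 0 :=
  Finset.sum_nonpos fun _ hi =>
    gradient_mul_disp_active_nonpos hx hα F q ((mem_activeSet_iff hx).1 hi)

/-- First order estimate: a step along a direction of inactive descent rate `κ` is accepted as soon
as it is short enough for the gradient Lipschitz constant and moves no inactive component out of
the orthant. -/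
lemma criterion_of_small (hf : ContDiff ℝ 2 f) {L : ℝ} (hL : 0 ≤ L)
    (hg : ∀ x ∈ orthant d, ∀ y ∈ orthant d, ‖gradient f x - gradient f y‖ ≤ L * ‖x - y‖)
    {ρ κ δ α : ℝ} (hρ' : ρ < 1 / 2) (hκ : 0 < κ) (hκ' : κ ≤ 1)
    {x : EuclideanSpace ℝ (Fin d)} (hx : x ∈ orthant d) (F : StepType)
    {q : EuclideanSpace ℝ (inactiveSet x δ)}
    (hq : κ * ‖q‖ ^ 2 ≤ -inner ℝ (subvec (inactiveSet x δ) (gradient f x)) q)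
    (hα : 0 < α) (hαL : α * (2 * L + 1) ≤ κ) (hαq : α * ‖q‖ ≤ δ) :
    LineSearchCriterion f ρ δ x (direction f δ x F q) α := by
  rw [lineSearchCriterion_iff]
  set v := disp x (direction f δ x F q) α with hv
  set G := inner ℝ (subvec (inactiveSet x δ) (gradient f x)) q with hG
  set S := ∑ i ∈ activeSet x δ, gradient f x i * v i with hS
  have hin : inner ℝ (gradient f x) v = S + α * G := by
    rw [inner_eq_sum, ← sum_activeSet_add_sum_inactiveSet hx δ, hG, inner_subvec, Finset.mul_sum]
    congr 1
    refine Finset.sum_congr rfl fun i hi => ?_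
    rw [hv, disp_inactive hα.le F hαq hi]; ring
  have hnorm : ‖v‖ ^ 2 ≤ -(α * S) + α ^ 2 * ‖q‖ ^ 2 := by
    rw [EuclideanSpace.real_norm_sq_eq, ← sum_activeSet_add_sum_inactiveSet hx δ, hS,
      Finset.mul_sum, ← Finset.sum_neg_distrib]
    refine add_le_add (Finset.sum_le_sum fun i hi =>
      disp_active_sq_le hx F q ((mem_activeSet_iff hx).1 hi)) (le_of_eq ?_)
    have h1 : ‖q‖ ^ 2 = ∑ i ∈ inactiveSet x δ, zeroExt _ q i ^ 2 := by
      rw [← norm_subvec_sq, subvec_zeroExt]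
    rw [h1, Finset.mul_sum]
    refine Finset.sum_congr rfl fun i hi => ?_
    rw [hv, disp_inactive hα.le F hαq hi]; ring
  have hS0 : S ≤ 0 := sum_active_disp_nonpos hx hα F q
  have hT := le_taylor_one hf hL hg hx (proj_mem_orthant (x + α • direction f δ x F q))
  change _ ≤ f x + inner ℝ (gradient f x) v + L * ‖v‖ ^ 2 at hT
  rw [hin] at hT
  have h1 : κ * ‖v‖ ^ 2 ≤ -(α * (S + α * G)) := by
    have h2 := mul_le_mul_of_nonneg_left hnorm hκ.le
    have h3 : κ * -(α * S) ≤ -(α * S) := by nlinarith [mul_nonneg hα.le (neg_nonneg.2 hS0)]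
    have h4 := mul_le_mul_of_nonneg_left hq (sq_nonneg α)
    nlinarith
  have h2 : (2 * L + 1) * ‖v‖ ^ 2 ≤ -(S + α * G) := by
    have h3 := mul_le_mul_of_nonneg_right hαL (sq_nonneg ‖v‖)
    refine le_of_mul_le_mul_left ?_ hα
    linarith
  have h5 : S + α * G ≤ 0 := by nlinarith [mul_nonneg hL (sq_nonneg ‖v‖), sq_nonneg ‖v‖]
  nlinarith [sq_nonneg ‖v‖]

lemma exists_criterion_of_small (hf : ContDiff ℝ 2 f) {L : ℝ} (hL : 0 ≤ L)
    (hg : ∀ x ∈ orthant d, ∀ y ∈ orthant d, ‖gradient f x - gradient f y‖ ≤ L * ‖x - y‖)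
    {ρ κ δ : ℝ} (hρ' : ρ < 1 / 2) (hκ : 0 < κ) (hκ' : κ ≤ 1) (hδ : 0 < δ)
    {x : EuclideanSpace ℝ (Fin d)} (hx : x ∈ orthant d) (F : StepType)
    {q : EuclideanSpace ℝ (inactiveSet x δ)}
    (hq : κ * ‖q‖ ^ 2 ≤ -inner ℝ (subvec (inactiveSet x δ) (gradient f x)) q) :
    ∃ a > 0, ∀ α, 0 < α → α ≤ a → LineSearchCriterion f ρ δ x (direction f δ x F q) α := by
  refine ⟨min (κ / (2 * L + 1)) (δ / (‖q‖ + 1)), by positivity, fun α hα hle => ?_⟩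
  refine criterion_of_small hf hL hg hρ' hκ hκ' hx F hq hα ?_ ?_
  · exact (le_div_iff₀ (by positivity)).1 (hle.trans (min_le_left _ _))
  · have h := (le_div_iff₀ (by positivity)).1 (hle.trans (min_le_right _ _))
    linarith

lemma disp_typeII_active {x : EuclideanSpace ℝ (Fin d)} (hx : x ∈ orthant d) {δ α : ℝ}
    (q : EuclideanSpace ℝ (inactiveSet x δ)) :
    ∑ i ∈ activeSet x δ, gradient f x i * disp x (direction f δ x StepType.typeII q) α i = 0 := by
  refine Finset.sum_eq_zero fun i hi => ?_
  rw [disp_apply, direction_typeII, zeroExt_apply_notMem q ((mem_activeSet_iff hx).1 hi), mul_zero,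
    add_zero, max_eq_left (hx i), sub_self, mul_zero]

/-- Second order estimate along a Type II step that stays in the orthant. -/
lemma typeII_le_taylor (hf : ContDiff ℝ 2 f) {L : ℝ} (hL : 0 ≤ L)
    (hH : ∀ x ∈ orthant d, ∀ y ∈ orthant d, ‖hess f x - hess f y‖ ≤ L * ‖x - y‖)
    {δ α : ℝ} {x : EuclideanSpace ℝ (Fin d)} (hx : x ∈ orthant d)
    {q : EuclideanSpace ℝ (inactiveSet x δ)} (hα : 0 ≤ α) (hαq : α * ‖q‖ ≤ δ) :
    f (proj (x + α • direction f δ x StepType.typeII q)) ≤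
      f x + α * inner ℝ (subvec (inactiveSet x δ) (gradient f x)) q +
        α ^ 2 / 2 * inner ℝ q (subHess f (inactiveSet x δ) x q) + L * (α * ‖q‖) ^ 3 := by
  have hmem := add_smul_zeroExt_mem_orthant hx hα hαq
  rw [direction_typeII, proj_of_mem hmem]
  have h := le_taylor_two hf hL hH hx hmem
  rw [add_sub_cancel_left, map_smul, real_inner_smul_left, real_inner_smul_right,
    real_inner_smul_right, inner_zeroExt, ← inner_subHess, norm_smul, norm_zeroExt,
    Real.norm_of_nonneg hα] at h
  linarith

/-- A SOL step of Type II is accepted for every `α ≤ 1` with `α ‖q‖` at most `δ` and below a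
fixed threshold. These conditions hold at `α = 1` when `q` is short: such steps are taken in full. -/
lemma criterion_typeII_sol (hf : ContDiff ℝ 2 f) {L : ℝ} (hL : 0 ≤ L)
    (hH : ∀ x ∈ orthant d, ∀ y ∈ orthant d, ‖hess f x - hess f y‖ ≤ L * ‖x - y‖)
    {ρ σ δ α : ℝ} (hρ' : ρ < 1 / 2)
    {x : EuclideanSpace ℝ (Fin d)} (hx : x ∈ orthant d) {q : EuclideanSpace ℝ (inactiveSet x δ)}
    (hq1 : inner ℝ (subvec (inactiveSet x δ) (gradient f x)) q ≤
      -inner ℝ q (subHess f (inactiveSet x δ) x q))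
    (hq2 : σ * ‖q‖ ^ 2 ≤ inner ℝ q (subHess f (inactiveSet x δ) x q)) (hσ : 0 ≤ σ)
    (hα : 0 < α) (hα1 : α ≤ 1) (hαq : α * ‖q‖ ≤ δ) (hαL : L * (α * ‖q‖) ≤ (1 / 2 - ρ) * σ) :
    LineSearchCriterion f ρ δ x (direction f δ x StepType.typeII q) α := by
  rw [lineSearchCriterion_iff, disp_typeII_active hx]
  have hT := typeII_le_taylor hf hL hH hx hα.le hαq
  set G := inner ℝ (subvec (inactiveSet x δ) (gradient f x)) q
  set c := inner ℝ q (subHess f (inactiveSet x δ) x q)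
  have hc : 0 ≤ c := le_trans (by positivity) hq2
  have h1 : α * ((1 - ρ) * G) ≤ α * ((1 - ρ) * -c) :=
    mul_le_mul_of_nonneg_left (mul_le_mul_of_nonneg_left hq1 (by linarith)) hα.le
  have h2 : α ^ 2 / 2 * c ≤ α * (c / 2) := by
    have : α * α ≤ α * 1 := mul_le_mul_of_nonneg_left hα1 hα.le
    nlinarith
  have h3 : L * (α * ‖q‖) ^ 3 ≤ α * ((1 / 2 - ρ) * c) := by
    have h4 : L * (α * ‖q‖) * (α ^ 2 * ‖q‖ ^ 2) ≤ (1 / 2 - ρ) * σ * (α ^ 2 * ‖q‖ ^ 2) :=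
      mul_le_mul_of_nonneg_right hαL (by positivity)
    have h5 : (1 / 2 - ρ) * (σ * ‖q‖ ^ 2) ≤ (1 / 2 - ρ) * c :=
      mul_le_mul_of_nonneg_left hq2 (by linarith)
    have h6 : α ^ 2 ≤ α := by nlinarith
    have h7 : α ^ 2 * ((1 / 2 - ρ) * (σ * ‖q‖ ^ 2)) ≤ α * ((1 / 2 - ρ) * c) :=
      mul_le_mul h6 h5 (mul_nonneg (by linarith) (by positivity)) hα.le
    calc L * (α * ‖q‖) ^ 3 = L * (α * ‖q‖) * (α ^ 2 * ‖q‖ ^ 2) := by ring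
      _ ≤ _ := h4
      _ = α ^ 2 * ((1 / 2 - ρ) * (σ * ‖q‖ ^ 2)) := by ring
      _ ≤ _ := h7
  linarith

/-- Along nonpositive curvature the quadratic term helps, so only the cubic term limits `α`, with no
cap at `1`. -/
lemma criterion_typeII_npc (hf : ContDiff ℝ 2 f) {L : ℝ} (hL : 0 ≤ L)
    (hH : ∀ x ∈ orthant d, ∀ y ∈ orthant d, ‖hess f x - hess f y‖ ≤ L * ‖x - y‖)
    {ρ δ α : ℝ} (hρ' : ρ < 1 / 2)
    {x : EuclideanSpace ℝ (Fin d)} (hx : x ∈ orthant d) {q : EuclideanSpace ℝ (inactiveSet x δ)}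
    (hq1 : inner ℝ (subvec (inactiveSet x δ) (gradient f x)) q = -‖q‖ ^ 2)
    (hq2 : inner ℝ q (subHess f (inactiveSet x δ) x q) ≤ 0)
    (hα : 0 < α) (hαq : α * ‖q‖ ≤ δ) (hαL : L * (α ^ 2 * ‖q‖) ≤ 1 / 2) :
    LineSearchCriterion f ρ δ x (direction f δ x StepType.typeII q) α := by
  rw [lineSearchCriterion_iff, disp_typeII_active hx]
  have hT := typeII_le_taylor hf hL hH hx hα.le hαq
  rw [hq1] at hT ⊢
  have h1 : α ^ 2 / 2 * inner ℝ q (subHess f (inactiveSet x δ) x q) ≤ 0 :=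
    mul_nonpos_of_nonneg_of_nonpos (by positivity) hq2
  have h2 : L * (α * ‖q‖) ^ 3 ≤ α * ‖q‖ ^ 2 * (1 / 2) := by
    have := mul_le_mul_of_nonneg_right hαL (by positivity : 0 ≤ α * ‖q‖ ^ 2)
    nlinarith
  have h3 : 0 ≤ α * ‖q‖ ^ 2 * (1 / 2 - ρ) := mul_nonneg (by positivity) (by linarith)
  linarith

end Criterion

/-! ### Decrease of the objective in one iteration -/

section Decrease

variable {d : ℕ} {f : EuclideanSpace ℝ (Fin d) → ℝ}

lemma flag_eq_typeI {δ ε : ℝ} {x : EuclideanSpace ℝ (Fin d)}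
    (h : flag f δ ε x = some StepType.typeI) :
    ¬ ActiveSignCond f δ ε x ∨ ¬ ActiveNormCond f δ (ε ^ 2) x := by
  unfold flag at h
  split_ifs at h with h1 h2
  · exact h1.2
  · simp at h

lemma flag_eq_typeII {δ ε : ℝ} {x : EuclideanSpace ℝ (Fin d)}
    (h : flag f δ ε x = some StepType.typeII) : ¬ InactiveNormCond f δ (ε ^ 2) x := by
  unfold flag at h
  split_ifs at h with h1 h2
  · simp at h
  · exact h2.2

lemma norm_subvec_empty {J : Finset (Fin d)} (hJ : ¬ J.Nonempty) (v : EuclideanSpace ℝ (Fin d)) :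
    ‖subvec J v‖ = 0 := by
  have h := norm_subvec_sq J v
  rw [Finset.not_nonempty_iff_eq_empty.1 hJ] at h
  rw [Finset.not_nonempty_iff_eq_empty.1 hJ]
  simpa using h

lemma isFO_of_flag_eq_none {e : ℝ} (he : 0 ≤ e) {x : EuclideanSpace ℝ (Fin d)}
    (h : flag f (√e) (√e) x = none) : IsFO f e x := by
  unfold flag at h
  rw [Real.sq_sqrt he] at h
  split_ifs at h with h1 h2
  rw [not_and_or, not_or, not_not, not_not] at h1
  rw [not_and_or, not_not] at h2
  have hA : ActiveSignCond f (√e) (√e) x ∧ ActiveNormCond f (√e) e x := by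
    rcases h1 with h1 | h1
    · refine ⟨fun i hi => absurd ⟨i, hi⟩ h1, ?_⟩
      rw [ActiveNormCond, norm_subvec_empty h1]; exact he
    · exact h1
  refine ⟨hA.1, hA.2, ?_⟩
  rcases h2 with h2 | h2
  · rw [InactiveNormCond, norm_subvec_empty h2]; exact he
  · exact h2

/-- The projected gradient step on the active block gains at least `min(α, 1) ε² / 2` in the linear
model when one of the two conditions on the active block is violated. -/
lemma sum_active_disp_le {ε α : ℝ} (hε : 0 < ε) (hα : 0 < α) {x : EuclideanSpace ℝ (Fin d)}
    (hx : x ∈ orthant d) (hflag : flag f ε ε x = some StepType.typeI)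
    (q : EuclideanSpace ℝ (inactiveSet x ε)) :
    ∑ i ∈ activeSet x ε, gradient f x i * disp x (direction f ε x StepType.typeI q) α i
      ≤ -(min α 1 * ε ^ 2 / 2) := by
  set D : Fin d → ℝ := fun i =>
    -(gradient f x i * disp x (direction f ε x StepType.typeI q) α i) with hD
  have hD0 : ∀ i ∈ activeSet x ε, 0 ≤ D i := fun i hi =>
    neg_nonneg.2 (gradient_mul_disp_active_nonpos hx hα _ q ((mem_activeSet_iff hx).1 hi))
  -- componentwise, either the projection is inactive or the component is moved to `0`
  have hval : ∀ i ∈ activeSet x ε,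
      (α * gradient f x i ≤ x i ∧ D i = α * gradient f x i ^ 2) ∨
        D i = x i * gradient f x i := by
    intro i hi
    have hi' := (mem_activeSet_iff hx).1 hi
    rcases le_total (α * gradient f x i) (x i) with h | h
    · left
      refine ⟨h, ?_⟩
      simp only [hD, disp_apply, direction_typeI_apply x ε q hi']
      rw [max_eq_left (by linarith)]; ring
    · right
      simp only [hD, disp_apply, direction_typeI_apply x ε q hi']
      rw [max_eq_right (by linarith)]; ring
  have hsum : ∑ i ∈ activeSet x ε, gradient f x i * disp x (direction f ε x StepType.typeI q) α i
      = -∑ i ∈ activeSet x ε, D i := by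
    rw [← Finset.sum_neg_distrib]
    exact Finset.sum_congr rfl fun i _ => by simp [hD]
  rw [hsum, neg_le_neg_iff]
  set S := ∑ i ∈ activeSet x ε, D i with hS
  have hS0 : 0 ≤ S := Finset.sum_nonneg hD0
  have hm : 0 < min α 1 := lt_min hα one_pos
  rcases flag_eq_typeI hflag with h | h
  · simp only [ActiveSignCond, not_forall, not_le] at h
    obtain ⟨i, hi, hgi⟩ := h
    have hDS : D i ≤ S := Finset.single_le_sum hD0 hi
    have hxi := hx i
    have hDi : α * ε ^ 2 ≤ D i := by
      have hg2 : ε ^ 2 ≤ gradient f x i ^ 2 := by nlinarith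
      have h0 : α * gradient f x i ≤ x i :=
        (mul_nonpos_of_nonneg_of_nonpos hα.le (by linarith)).trans hxi
      have hi' := (mem_activeSet_iff hx).1 hi
      have : D i = α * gradient f x i ^ 2 := by
        simp only [hD, disp_apply, direction_typeI_apply x ε q hi']
        rw [max_eq_left (by linarith)]; ring
      rw [this]
      exact mul_le_mul_of_nonneg_left hg2 hα.le
    have h1 : min α 1 * ε ^ 2 ≤ α * ε ^ 2 :=
      mul_le_mul_of_nonneg_right (min_le_left _ _) (sq_nonneg ε)
    have h2 : 0 ≤ min α 1 * ε ^ 2 := by positivity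
    linarith
  · rw [ActiveNormCond, not_le] at h
    have h4 : (ε ^ 2) ^ 2 < ∑ i ∈ activeSet x ε, (x i * gradient f x i) ^ 2 := by
      have := pow_lt_pow_left₀ h (by positivity) two_ne_zero
      rwa [norm_subvec_sq] at this
    have hterm : ∀ i ∈ activeSet x ε,
        (x i * gradient f x i) ^ 2 ≤ ε ^ 2 / α * D i + S * D i := by
      intro i hi
      have hDi := hD0 i hi
      have hDS : D i ≤ S := Finset.single_le_sum hD0 hi
      have hxi := hx i
      have hxe : x i ≤ ε := by
        have : 0 ≤ x i ∧ x i ≤ ε := by simpa [activeSet] using hi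
        exact this.2
      rcases hval i hi with ⟨-, h⟩ | h
      · have h1 : ε ^ 2 / α * D i = ε ^ 2 * gradient f x i ^ 2 := by
          rw [h]; field_simp
        have h2 : x i ^ 2 ≤ ε ^ 2 := pow_le_pow_left₀ hxi hxe 2
        have h3 := mul_le_mul_of_nonneg_right h2 (sq_nonneg (gradient f x i))
        have h5 := mul_nonneg hS0 hDi
        rw [h1, mul_pow]
        linarith
      · rw [← h, sq]
        have h1 : 0 ≤ ε ^ 2 / α * D i := by positivity
        have h2 := mul_le_mul_of_nonneg_right hDS hDi
        linarith
    have h5 := h4.trans_le (Finset.sum_le_sum hterm)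
    rw [Finset.sum_add_distrib, ← Finset.mul_sum, ← Finset.mul_sum, ← hS] at h5
    by_contra hcon
    rw [not_le] at hcon
    have h6 : ε ^ 2 / α * S ≤ (ε ^ 2) ^ 2 / 2 := by
      have h7 : S ≤ α * ε ^ 2 / 2 := by
        have := mul_le_mul_of_nonneg_right (min_le_left α 1) (sq_nonneg ε)
        linarith
      calc ε ^ 2 / α * S ≤ ε ^ 2 / α * (α * ε ^ 2 / 2) :=
            mul_le_mul_of_nonneg_left h7 (by positivity)
        _ = _ := by field_simp
    have h8 : S ≤ ε ^ 2 / 2 := by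
      have := mul_le_mul_of_nonneg_right (min_le_right α 1) (sq_nonneg ε)
      linarith
    have h9 : S * S ≤ ε ^ 2 / 2 * (ε ^ 2 / 2) := mul_le_mul h8 h8 hS0 (by positivity)
    have h10 : 0 < (ε ^ 2) ^ 2 := by positivity
    nlinarith

/-- Every Type I step decreases the objective by a multiple of `ε³`. -/
lemma typeI_decrease (hf : ContDiff ℝ 2 f) {L : ℝ} (hL : 0 ≤ L)
    (hg : ∀ x ∈ orthant d, ∀ y ∈ orthant d, ‖gradient f x - gradient f y‖ ≤ L * ‖x - y‖)
    {ρ ζ κ ε α : ℝ} (hρ : 0 < ρ) (hρ' : ρ < 1 / 2) (hζ : 0 < ζ) (hζ' : ζ < 1) (hκ : 0 < κ)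
    (hκ' : κ ≤ 1) (hε : 0 < ε) (hε' : ε < 1) {x : EuclideanSpace ℝ (Fin d)} (hx : x ∈ orthant d)
    (hflag : flag f ε ε x = some StepType.typeI) {q : EuclideanSpace ℝ (inactiveSet x ε)}
    (hq : κ * ‖q‖ ^ 2 ≤ -inner ℝ (subvec (inactiveSet x ε) (gradient f x)) q) (hα : 0 < α)
    (hcrit : LineSearchCriterion f ρ ε x (direction f ε x StepType.typeI q) α)
    (hα' : 1 ≤ α ∨ ¬ LineSearchCriterion f ρ ε x (direction f ε x StepType.typeI q) (α / ζ)) :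
    f (proj (x + α • direction f ε x StepType.typeI q)) ≤
      f x - ρ * (ζ * κ / (2 * L + 1)) / 2 * ε ^ 3 := by
  rw [lineSearchCriterion_iff] at hcrit
  have hA := mul_le_mul_of_nonneg_left (sum_active_disp_le hε hα hx hflag q) hρ.le
  have hI := mul_le_mul_of_nonneg_left hq (mul_nonneg hα.le hρ.le)
  set a₀ := ζ * κ / (2 * L + 1) with ha₀
  have ha₀pos : 0 < a₀ := by positivity
  have ha₀ζκ : a₀ ≤ ζ * κ := div_le_self (by positivity) (by linarith)
  have hζκ : ζ * κ ≤ ζ := by nlinarith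
  have hε3 : ε ^ 3 ≤ ε ^ 2 := by nlinarith [sq_nonneg ε]
  have hε3' : ε ^ 3 ≤ ε := by nlinarith [sq_nonneg ε]
  have hmin : 0 < min α 1 := lt_min hα one_pos
  have hgain : f (proj (x + α • direction f ε x StepType.typeI q)) ≤
      f x - ρ * (min α 1 * ε ^ 2 / 2 + κ * (α * ‖q‖ ^ 2)) := by linarith
  suffices h : a₀ / 2 * ε ^ 3 ≤ min α 1 * ε ^ 2 / 2 + κ * (α * ‖q‖ ^ 2) by
    have := mul_le_mul_of_nonneg_left h hρ.le
    linarith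
  have hκq : 0 ≤ κ * (α * ‖q‖ ^ 2) := by positivity
  by_cases hbig : a₀ ≤ α
  · have h1 : a₀ ≤ min α 1 := le_min hbig (by linarith)
    have h2 : a₀ * ε ^ 3 ≤ min α 1 * ε ^ 2 := mul_le_mul h1 hε3 (by positivity) hmin.le
    linarith
  rw [not_le] at hbig
  -- the step was cut back, and not because of the gradient Lipschitz constant
  have hfail : ε < α / ζ * ‖q‖ := by
    by_contra hcon
    rw [not_lt] at hcon
    rcases hα' with h | h
    · linarith
    · refine h (criterion_of_small hf hL hg hρ' hκ hκ' hx _ hq (by positivity) ?_ hcon)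
      rw [ha₀, lt_div_iff₀ (by positivity)] at hbig
      rw [div_mul_eq_mul_div, div_le_iff₀ hζ]
      linarith
  have hfail' : ζ * ε < α * ‖q‖ := by
    rw [div_mul_eq_mul_div, lt_div_iff₀ hζ] at hfail; linarith
  rcases le_total 1 ‖q‖ with h | h
  · have h1 : ζ * ε ≤ α * ‖q‖ ^ 2 := by
      have : α * ‖q‖ * 1 ≤ α * ‖q‖ * ‖q‖ := mul_le_mul_of_nonneg_left h (by positivity)
      nlinarith
    have h2 : κ * (ζ * ε) ≤ κ * (α * ‖q‖ ^ 2) := mul_le_mul_of_nonneg_left h1 hκ.le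
    have h3 : a₀ * ε ^ 3 ≤ (ζ * κ) * ε := mul_le_mul ha₀ζκ hε3' (by positivity) (by positivity)
    have h4 : 0 ≤ min α 1 * ε ^ 2 / 2 := by positivity
    have h5 : 0 ≤ a₀ * ε ^ 3 := by positivity
    linarith
  · have h1 : ζ * ε ≤ α := by
      have : α * ‖q‖ ≤ α * 1 := mul_le_mul_of_nonneg_left h hα.le
      linarith
    have h2 : ζ * ε ≤ min α 1 := le_min h1 (by nlinarith)
    have h3 : ζ * ε * ε ^ 2 ≤ min α 1 * ε ^ 2 := mul_le_mul_of_nonneg_right h2 (sq_nonneg ε)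
    have h4 : a₀ * ε ^ 3 ≤ ζ * ε ^ 3 :=
      mul_le_mul_of_nonneg_right (ha₀ζκ.trans hζκ) (by positivity)
    have h5 : ζ * ε * ε ^ 2 = ζ * ε ^ 3 := by ring
    linarith

/-- Every Type II step along a direction of nonpositive curvature decreases the objective by a
multiple of `ε³`. -/
lemma typeII_npc_decrease (hf : ContDiff ℝ 2 f) {L : ℝ} (hL : 0 ≤ L)
    (hH : ∀ x ∈ orthant d, ∀ y ∈ orthant d, ‖hess f x - hess f y‖ ≤ L * ‖x - y‖)
    {ρ ζ ω ε α : ℝ} (hρ : 0 < ρ) (hρ' : ρ < 1 / 2) (hζ : 0 < ζ) (hω : 0 < ω)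
    (hε : 0 < ε) {x : EuclideanSpace ℝ (Fin d)} (hx : x ∈ orthant d)
    (hflag : flag f ε ε x = some StepType.typeII) {q : EuclideanSpace ℝ (inactiveSet x ε)}
    (hq1 : inner ℝ (subvec (inactiveSet x ε) (gradient f x)) q = -‖q‖ ^ 2)
    (hq2 : inner ℝ q (subHess f (inactiveSet x ε) x q) ≤ 0)
    (hq3 : ω * ‖subvec (inactiveSet x ε) (gradient f x)‖ ≤ ‖q‖) (hα : 0 < α)
    (hcrit : LineSearchCriterion f ρ ε x (direction f ε x StepType.typeII q) α)
    (hα' : ¬ LineSearchCriterion f ρ ε x (direction f ε x StepType.typeII q) (α / ζ)) :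
    f (proj (x + α • direction f ε x StepType.typeII q)) ≤
      f x - ρ * ζ * min ω √(ω ^ 3 / (2 * (L + 1))) * ε ^ 3 := by
  have hgI := flag_eq_typeII hflag
  rw [InactiveNormCond, not_le] at hgI
  have hqω : ω * ε ^ 2 ≤ ‖q‖ := (mul_le_mul_of_nonneg_left hgI.le hω.le).trans hq3
  have hq0 : 0 < ‖q‖ := lt_of_lt_of_le (by positivity) hqω
  rw [lineSearchCriterion_iff, disp_typeII_active hx, hq1] at hcrit
  obtain ⟨a, ha⟩ : ∃ a, a = α / ζ := ⟨_, rfl⟩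
  have hαa : α = ζ * a := by rw [ha]; field_simp
  have ha0 : 0 < a := by rw [ha]; positivity
  rw [← ha] at hα'
  suffices h : min ω √(ω ^ 3 / (2 * (L + 1))) * ε ^ 3 ≤ a * ‖q‖ ^ 2 by
    have := mul_le_mul_of_nonneg_left h (mul_nonneg hρ.le hζ.le)
    rw [hαa] at hcrit ⊢
    linarith
  by_cases h1 : a * ‖q‖ ≤ ε
  · have h2 : 1 / 2 < L * (a ^ 2 * ‖q‖) := by
      by_contra hcon
      exact hα' (criterion_typeII_npc hf hL hH hρ' hx hq1 hq2 ha0 h1 (not_lt.1 hcon))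
    have h3 : √(ω ^ 3 / (2 * (L + 1))) * ε ^ 3 ≤ a * ‖q‖ ^ 2 := by
      refine (sq_le_sq₀ (by positivity) (by positivity)).1 ?_
      rw [mul_pow, Real.sq_sqrt (by positivity), div_mul_eq_mul_div, div_le_iff₀ (by positivity)]
      have h4 : (ω * ε ^ 2) ^ 3 ≤ ‖q‖ ^ 3 := pow_le_pow_left₀ (by positivity) hqω 3
      have h5 : ‖q‖ ^ 3 * (1 / 2) ≤ ‖q‖ ^ 3 * ((L + 1) * (a ^ 2 * ‖q‖)) := by
        refine mul_le_mul_of_nonneg_left ?_ (by positivity)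
        nlinarith [(by positivity : 0 ≤ a ^ 2 * ‖q‖)]
      nlinarith
    exact (mul_le_mul_of_nonneg_right (min_le_right _ _) (by positivity)).trans h3
  · rw [not_le] at h1
    have h2 : ω * ε ^ 2 * ε ≤ ‖q‖ * (a * ‖q‖) := mul_le_mul hqω h1.le hε.le hq0.le
    have h3 : min ω √(ω ^ 3 / (2 * (L + 1))) * ε ^ 3 ≤ ω * ε ^ 3 :=
      mul_le_mul_of_nonneg_right (min_le_left _ _) (by positivity)
    nlinarith

/-- A Type II step with label SOL decreases the objective by a multiple of `ε³`, unless it is a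
full step after which the inactive gradient is small. In the second case no Type II step follows:
the active components have not moved, so the inactive set has not grown. -/
lemma typeII_sol_decrease (hf : ContDiff ℝ 2 f) {L M : ℝ} (hL : 0 ≤ L) (hM : 0 ≤ M)
    (hg : ∀ x ∈ orthant d, ∀ y ∈ orthant d, ‖gradient f x - gradient f y‖ ≤ L * ‖x - y‖)
    (hH : ∀ x ∈ orthant d, ∀ y ∈ orthant d, ‖hess f x - hess f y‖ ≤ M * ‖x - y‖)
    {ρ ζ σ B ε α : ℝ} (hρ : 0 < ρ) (hρ' : ρ < 1 / 2) (hζ : 0 < ζ) (hσ : 0 < σ)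
    (hB : 0 ≤ B) (hε : 0 < ε) (hε' : ε < 1) {x : EuclideanSpace ℝ (Fin d)} (hx : x ∈ orthant d)
    (hflag : flag f ε ε x = some StepType.typeII) {q : EuclideanSpace ℝ (inactiveSet x ε)}
    (hq1 : inner ℝ (subvec (inactiveSet x ε) (gradient f x)) q ≤
      -inner ℝ q (subHess f (inactiveSet x ε) x q))
    (hq2 : σ * ‖q‖ ^ 2 ≤ inner ℝ q (subHess f (inactiveSet x ε) x q))
    (hq3 : ‖subHess f (inactiveSet x ε) x q + subvec (inactiveSet x ε) (gradient f x)‖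
      ≤ B * ε * ‖q‖) (hα : 0 < α)
    (hcrit : LineSearchCriterion f ρ ε x (direction f ε x StepType.typeII q) α)
    (hα' : α = 1 ∨ (α / ζ ≤ 1 ∧
      ¬ LineSearchCriterion f ρ ε x (direction f ε x StepType.typeII q) (α / ζ))) :
    f (proj (x + α • direction f ε x StepType.typeII q)) ≤
      f x - ρ * σ * min (ζ * min 1 ((1 / 2 - ρ) * σ / (M + 1)) / (L + B + 1))
        ((1 / (B + M + 1)) ^ 2) * ε ^ 3 ∨
    flag f ε ε (proj (x + α • direction f ε x StepType.typeII q)) ≠ some StepType.typeII := by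
  have hgI := flag_eq_typeII hflag
  rw [InactiveNormCond, not_le] at hgI
  rw [lineSearchCriterion_iff, disp_typeII_active hx] at hcrit
  set gI := subvec (inactiveSet x ε) (gradient f x) with hgI'
  set τ := min 1 ((1 / 2 - ρ) * σ / (M + 1)) with hτ
  set τ' := 1 / (B + M + 1) with hτ'
  have hρ2 : 0 < 1 / 2 - ρ := by linarith
  have hτ0 : 0 < τ := by positivity
  have hτ'0 : 0 < τ' := by positivity
  have hτ'1 : τ' ≤ 1 := by rw [hτ', div_le_one (by positivity)]; linarith
  have hε3 : ε ^ 3 ≤ ε ^ 2 := by nlinarith [sq_nonneg ε]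
  have hgain : f (proj (x + α • direction f ε x StepType.typeII q)) ≤
      f x - ρ * σ * (α * ‖q‖ ^ 2) := by
    have := mul_le_mul_of_nonneg_left (hq2.trans (le_neg_of_le_neg hq1)) (mul_nonneg hα.le hρ.le)
    linarith
  have hfinish : min (ζ * τ / (L + B + 1)) (τ' ^ 2) * ε ^ 3 ≤ α * ‖q‖ ^ 2 →
      f (proj (x + α • direction f ε x StepType.typeII q)) ≤
      f x - ρ * σ * min (ζ * τ / (L + B + 1)) (τ' ^ 2) * ε ^ 3 := by
    intro h
    have := mul_le_mul_of_nonneg_left h (mul_nonneg hρ.le hσ.le)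
    linarith
  rcases hα' with rfl | ⟨h1, h2⟩
  · by_cases hlarge : τ' * ε ≤ ‖q‖
    · left
      refine hfinish ?_
      have h3 : (τ' * ε) ^ 2 ≤ ‖q‖ ^ 2 := pow_le_pow_left₀ (by positivity) hlarge 2
      have h4 : min (ζ * τ / (L + B + 1)) (τ' ^ 2) * ε ^ 3 ≤ τ' ^ 2 * ε ^ 2 :=
        mul_le_mul (min_le_right _ _) hε3 (by positivity) (by positivity)
      linarith [mul_pow τ' ε 2]
    · right
      rw [not_le] at hlarge
      have hqε : 1 * ‖q‖ ≤ ε := by nlinarith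
      have hmem := add_smul_zeroExt_mem_orthant hx zero_le_one hqε
      rw [direction_typeII, proj_of_mem hmem, one_smul]
      rw [one_smul] at hmem
      intro hcon
      have hnew := flag_eq_typeII hcon
      rw [InactiveNormCond, not_le] at hnew
      have hsub : inactiveSet (x + zeroExt _ q) ε ⊆ inactiveSet x ε := by
        intro i hi
        by_contra hi'
        have h3 : ε < (x + zeroExt _ q) i := (Finset.mem_filter.1 hi).2
        rw [PiLp.add_apply, zeroExt_apply_notMem q hi', add_zero] at h3
        exact hi' (Finset.mem_filter.2 ⟨Finset.mem_univ _, h3⟩)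
      have h3 := hnew.trans_le (norm_subvec_mono hsub _)
      have h4 : subvec (inactiveSet x ε) (gradient f (x + zeroExt _ q)) =
          subvec (inactiveSet x ε) (gradient f (x + zeroExt _ q) - gradient f x
            - hess f x (zeroExt _ q)) + (subHess f (inactiveSet x ε) x q + gI) := by
        rw [subHess_apply, hgI']
        ext i
        simp only [subvec, PiLp.add_apply, PiLp.sub_apply]
        ring
      have h5 : ‖subvec (inactiveSet x ε) (gradient f (x + zeroExt _ q) - gradient f x
            - hess f x (zeroExt _ q))‖ ≤ M * ‖q‖ ^ 2 := by
        refine (norm_subvec_le _ _).trans ?_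
        have := gradient_taylor hf hM hH hx hmem
        rwa [add_sub_cancel_left, norm_zeroExt] at this
      have h6 : ‖subvec (inactiveSet x ε) (gradient f (x + zeroExt _ q))‖
          ≤ M * ‖q‖ ^ 2 + B * ε * ‖q‖ := by
        rw [h4]
        exact (norm_add_le _ _).trans (add_le_add h5 hq3)
      have hqn := norm_nonneg q
      have h7 : M * ‖q‖ ^ 2 ≤ M * (τ' * ε ^ 2) := by
        refine mul_le_mul_of_nonneg_left ?_ hM
        have h8 : ‖q‖ ^ 2 ≤ (τ' * ε) ^ 2 := pow_le_pow_left₀ hqn hlarge.le 2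
        have h9 : τ' ^ 2 ≤ τ' := by nlinarith
        nlinarith [mul_le_mul_of_nonneg_right h9 (sq_nonneg ε)]
      have h8 : B * ε * ‖q‖ ≤ B * ε * (τ' * ε) :=
        mul_le_mul_of_nonneg_left hlarge.le (by positivity)
      have h9 : (B + M) * τ' ≤ 1 := by
        rw [hτ', mul_one_div, div_le_one (by positivity)]; linarith
      have h10 := mul_le_mul_of_nonneg_right h9 (sq_nonneg ε)
      linarith
  · left
    refine hfinish ?_
    obtain ⟨a, ha⟩ : ∃ a, a = α / ζ := ⟨_, rfl⟩
    have hαa : α = ζ * a := by rw [ha]; field_simp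
    have ha0 : 0 < a := by rw [ha]; positivity
    rw [← ha] at h1 h2
    have h3 : τ * ε ≤ a * ‖q‖ := by
      by_contra hcon
      rw [not_le] at hcon
      refine h2 (criterion_typeII_sol hf hM hH hρ' hx hq1 hq2 hσ.le ha0 h1 ?_ ?_)
      · have : τ * ε ≤ 1 * ε := mul_le_mul_of_nonneg_right (min_le_left _ _) hε.le
        linarith
      · have h4 : a * ‖q‖ ≤ (1 / 2 - ρ) * σ / (M + 1) := by
          have h5 : τ * ε ≤ τ * 1 := mul_le_mul_of_nonneg_left hε'.le hτ0.le
          have h6 : τ ≤ (1 / 2 - ρ) * σ / (M + 1) := min_le_right _ _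
          linarith
        rw [le_div_iff₀ (by positivity)] at h4
        have h5 : 0 ≤ a * ‖q‖ := by positivity
        linarith
    have h4 : ε ^ 2 ≤ (L + B + 1) * ‖q‖ := by
      have h5 : ‖gI‖ ≤ ‖subHess f (inactiveSet x ε) x q + gI‖ + ‖subHess f (inactiveSet x ε) x q‖ := by
        have := norm_sub_le (subHess f (inactiveSet x ε) x q + gI) (subHess f (inactiveSet x ε) x q)
        rwa [add_sub_cancel_left] at this
      have h6 := norm_subHess_apply_le hf hL hg hx hε q
      have h7 : B * ε * ‖q‖ ≤ B * ‖q‖ :=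
        mul_le_mul_of_nonneg_right (mul_le_of_le_one_right hB hε'.le) (norm_nonneg q)
      linarith [norm_nonneg q]
    have h5 : ε ^ 2 / (L + B + 1) ≤ ‖q‖ := by
      rw [div_le_iff₀ (by positivity)]; linarith
    have h6 : τ * ε * (ε ^ 2 / (L + B + 1)) ≤ a * ‖q‖ * ‖q‖ :=
      mul_le_mul h3 h5 (by positivity) (by positivity)
    have h7 := mul_le_mul_of_nonneg_left h6 hζ.le
    have h8 : min (ζ * τ / (L + B + 1)) (τ' ^ 2) * ε ^ 3 ≤ ζ * τ / (L + B + 1) * ε ^ 3 :=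
      mul_le_mul_of_nonneg_right (min_le_left _ _) (by positivity)
    have h9 : ζ * (τ * ε * (ε ^ 2 / (L + B + 1))) = ζ * τ / (L + B + 1) * ε ^ 3 := by ring
    rw [hαa]
    linarith

end Decrease

/-! ### Complexity of the method -/

section Complexity

variable {d : ℕ} {f : EuclideanSpace ℝ (Fin d) → ℝ}

/-- The smallest of the three coefficients of `ε³` in the guaranteed decreases: of Type I steps, of
Type II steps with label NPC, and of Type II steps with label SOL. -/
noncomputable def decreaseConst (L M ω σ ρ θ ζ : ℝ) : ℝ :=
  min (ρ * (ζ * min 1 σ / (2 * L + 1)) / 2)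
    (min (ρ * ζ * min ω √(ω ^ 3 / (2 * (M + 1))))
      (ρ * σ * min (ζ * min 1 ((1 / 2 - ρ) * σ / (M + 1)) / (L + θ * L / σ + 1))
        ((1 / (θ * L / σ + M + 1)) ^ 2)))

lemma decreaseConst_pos {L M ω σ ρ θ ζ : ℝ} (hL : 0 ≤ L) (hM : 0 ≤ M) (hω : 0 < ω) (hσ : 0 < σ)
    (hρ : 0 < ρ) (hρ' : ρ < 1 / 2) (hθ : 0 < θ) (hζ : 0 < ζ) :
    0 < decreaseConst L M ω σ ρ θ ζ := by
  have : 0 < 1 / 2 - ρ := by linarith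
  unfold decreaseConst
  positivity

lemma MinresCall.npc_spec {θ δ ε : ℝ} {x : EuclideanSpace ℝ (Fin d)} {t : ℕ}
    {q : EuclideanSpace ℝ (inactiveSet x δ)} (h : MinresCall f θ δ ε x t q DType.NPC) (σ : ℝ) :
    q ≠ 0 ∧ inner ℝ q (subHess f (inactiveSet x δ) x q) ≤ 0 ∧
      inner ℝ (subvec (inactiveSet x δ) (gradient f x)) q = -‖q‖ ^ 2 ∧
      min 1 σ * ‖q‖ ^ 2 ≤ -inner ℝ (subvec (inactiveSet x δ) (gradient f x)) q := by
  obtain ⟨h1, h2, h3⟩ := MinresReturns.npc_spec h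
  refine ⟨h1, h2, h3, ?_⟩
  rw [h3, neg_neg]
  exact mul_le_of_le_one_left (sq_nonneg _) (min_le_left _ _)

lemma MinresCall.sol_spec (hf : ContDiff ℝ 2 f) {L : ℝ} (hL : 0 ≤ L)
    (hg : ∀ x ∈ orthant d, ∀ y ∈ orthant d, ‖gradient f x - gradient f y‖ ≤ L * ‖x - y‖)
    {θ ε σ : ℝ} (hθ : 0 < θ) (hε : 0 < ε) (hσ : 0 < σ)
    {x : EuclideanSpace ℝ (Fin d)} (hx : x ∈ orthant d) {t : ℕ}
    {q : EuclideanSpace ℝ (inactiveSet x ε)} (h : MinresCall f θ ε ε x t q DType.SOL)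
    (hT : LanczosBoundedBelow (subHess f (inactiveSet x ε) x)
      (subvec (inactiveSet x ε) (gradient f x)) t σ) :
    inner ℝ (subvec (inactiveSet x ε) (gradient f x)) q ≤
        -inner ℝ q (subHess f (inactiveSet x ε) x q) ∧
      σ * ‖q‖ ^ 2 ≤ inner ℝ q (subHess f (inactiveSet x ε) x q) ∧
      ‖subHess f (inactiveSet x ε) x q + subvec (inactiveSet x ε) (gradient f x)‖
        ≤ θ * L / σ * ε * ‖q‖ ∧
      min 1 σ * ‖q‖ ^ 2 ≤ -inner ℝ (subvec (inactiveSet x ε) (gradient f x)) q := by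
  obtain ⟨h1, h2, h3⟩ := MinresReturns.sol_regular (subHess_isSymmetric hf _ x)
    (by positivity) h hT
  refine ⟨h1, h2, ?_, ?_⟩
  · have h4 := norm_subHess_apply_le hf hL hg hx hε q
    have h5 := h3.trans (mul_le_mul_of_nonneg_left h4 (by positivity : 0 ≤ ε * θ))
    have e : θ * L / σ * ε * ‖q‖ = ε * θ * (L * ‖q‖) / σ := by ring
    rw [e, le_div_iff₀ hσ]
    linarith
  · have := mul_le_mul_of_nonneg_right (min_le_right 1 σ) (sq_nonneg ‖q‖)
    linarith

/-- The effect of one iteration: either a decrease by a multiple of `ε³`, or a Type II step after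
which no further Type II step is due. -/
lemma AlgStep.decrease (hf : ContDiff ℝ 2 f) {L M : ℝ} (hL : 0 ≤ L) (hM : 0 ≤ M)
    (hg : ∀ x ∈ orthant d, ∀ y ∈ orthant d, ‖gradient f x - gradient f y‖ ≤ L * ‖x - y‖)
    (hH : ∀ x ∈ orthant d, ∀ y ∈ orthant d, ‖hess f x - hess f y‖ ≤ M * ‖x - y‖)
    {ω σ ρ θ ζ ε : ℝ} (hω : 0 < ω) (hσ : 0 < σ) (hρ : 0 < ρ) (hρ' : ρ < 1 / 2) (hθ : 0 < θ)
    (hζ : 0 < ζ) (hζ' : ζ < 1) (hε : 0 < ε) (hε' : ε < 1)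
    {x x' : EuclideanSpace ℝ (Fin d)} (hx : x ∈ orthant d)
    (hnpc : ∀ t q, MinresCall f θ ε ε x t q DType.NPC →
      ω * ‖subvec (inactiveSet x ε) (gradient f x)‖ ≤ ‖q‖)
    (hreg : ∀ t q, MinresCall f θ ε ε x t q DType.SOL →
      LanczosBoundedBelow (subHess f (inactiveSet x ε) x)
        (subvec (inactiveSet x ε) (gradient f x)) t σ)
    (h : AlgStep f ρ ζ θ ε ε x x') :
    x' ∈ orthant d ∧ f x' ≤ f x ∧
      (f x' ≤ f x - decreaseConst L M ω σ ρ θ ζ * ε ^ 3 ∨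
        (flag f ε ε x = some StepType.typeII ∧ flag f ε ε x' ≠ some StepType.typeII)) := by
  obtain ⟨F, t, q, D, α, hflag, hcall, hls, rfl⟩ := h
  refine ⟨proj_mem_orthant _, ?_⟩
  have hε3 : 0 ≤ ε ^ 3 := by positivity
  obtain ⟨hc1, hc2, hc3⟩ :
      decreaseConst L M ω σ ρ θ ζ ≤ ρ * (ζ * min 1 σ / (2 * L + 1)) / 2 ∧
      decreaseConst L M ω σ ρ θ ζ ≤ ρ * ζ * min ω √(ω ^ 3 / (2 * (M + 1))) ∧
      decreaseConst L M ω σ ρ θ ζ ≤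
        ρ * σ * min (ζ * min 1 ((1 / 2 - ρ) * σ / (M + 1)) / (L + θ * L / σ + 1))
          ((1 / (θ * L / σ + M + 1)) ^ 2) :=
    ⟨min_le_left _ _, (min_le_right _ _).trans (min_le_left _ _),
      (min_le_right _ _).trans (min_le_right _ _)⟩
  replace hc1 := mul_le_mul_of_nonneg_right hc1 hε3
  replace hc2 := mul_le_mul_of_nonneg_right hc2 hε3
  replace hc3 := mul_le_mul_of_nonneg_right hc3 hε3
  have hκ : 0 < min 1 σ := lt_min one_pos hσ
  have hdesc : ∀ {α : ℝ}, 0 < α →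
      min 1 σ * ‖q‖ ^ 2 ≤ -inner ℝ (subvec (inactiveSet x ε) (gradient f x)) q →
      LineSearchCriterion f ρ ε x (direction f ε x F q) α →
      f (proj (x + α • direction f ε x F q)) ≤ f x := by
    intro α hα hq hcrit
    rw [lineSearchCriterion_iff] at hcrit
    have h1 := mul_nonpos_of_nonneg_of_nonpos hρ.le (sum_active_disp_nonpos (f := f) hx hα F q)
    have h2 : inner ℝ (subvec (inactiveSet x ε) (gradient f x)) q ≤ 0 := by
      have : 0 ≤ min 1 σ * ‖q‖ ^ 2 := by positivity
      linarith
    have h3 := mul_nonpos_of_nonneg_of_nonpos (mul_nonneg hα.le hρ.le) h2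
    linarith
  cases D with
  | NPC =>
    obtain ⟨-, hq1, hq2, hq3⟩ := hcall.npc_spec σ
    obtain ⟨hcrit, hα, hfail⟩ := ForwardReturns.spec hζ hζ' hls
    refine ⟨hdesc hα hq3 hcrit, Or.inl ?_⟩
    cases F with
    | typeI =>
      have := typeI_decrease hf hL hg hρ hρ' hζ hζ' hκ (min_le_left _ _) hε hε' hx hflag hq3 hα
        hcrit (Or.inr hfail)
      linarith
    | typeII =>
      have := typeII_npc_decrease hf hM hH hρ hρ' hζ hω hε hx hflag hq2 hq1 (hnpc t q hcall) hα
        hcrit hfail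
      linarith
  | SOL =>
    obtain ⟨hq1, hq2, hq3, hq4⟩ := hcall.sol_spec hf hL hg hθ hε hσ hx (hreg t q hcall)
    obtain ⟨hcrit, hα, hfail⟩ := BacktrackReturns.spec hζ hζ' hls
    refine ⟨hdesc hα hq4 hcrit, ?_⟩
    cases F with
    | typeI =>
      have := typeI_decrease hf hL hg hρ hρ' hζ hζ' hκ (min_le_left _ _) hε hε' hx hflag hq4 hα
        hcrit (hfail.imp (fun h => h.ge) fun h => h.2)
      left; linarith
    | typeII =>
      rcases typeII_sol_decrease hf hL hM hg hH hρ hρ' hζ hσ (by positivity : 0 ≤ θ * L / σ) hε hε'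
        hx hflag hq1 hq2 hq3 hα hcrit hfail with h | h
      · left; linarith
      · exact Or.inr ⟨hflag, h⟩

/-- An iteration that starts is completed: MINRES terminates, backtracking succeeds because short
steps are accepted, and forward tracking ends because the objective is bounded below. -/
lemma exists_algStep (hf : ContDiff ℝ 2 f) {L : ℝ} (hL : 0 ≤ L)
    (hg : ∀ x ∈ orthant d, ∀ y ∈ orthant d, ‖gradient f x - gradient f y‖ ≤ L * ‖x - y‖)
    {fstar : ℝ} (hfstar : ∀ x ∈ orthant d, fstar ≤ f x)
    {σ ρ θ ζ ε : ℝ} (hσ : 0 < σ) (hρ : 0 < ρ) (hρ' : ρ < 1 / 2) (hθ : 0 < θ)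
    (hζ : 0 < ζ) (hζ' : ζ < 1) (hε : 0 < ε)
    {x : EuclideanSpace ℝ (Fin d)} (hx : x ∈ orthant d)
    (hreg : ∀ t q, MinresCall f θ ε ε x t q DType.SOL →
      LanczosBoundedBelow (subHess f (inactiveSet x ε) x)
        (subvec (inactiveSet x ε) (gradient f x)) t σ)
    (hflag : flag f ε ε x ≠ none) : ∃ x', AlgStep f ρ ζ θ ε ε x x' := by
  obtain ⟨F, hF⟩ := Option.ne_none_iff_exists'.1 hflag
  obtain ⟨t, q, D, hcall⟩ := exists_minresReturns (subHess_isSymmetric hf (inactiveSet x ε) x)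
    (subvec (inactiveSet x ε) (gradient f x)) (by positivity : 0 ≤ ε * θ)
  have hκ : 0 < min 1 σ := lt_min one_pos hσ
  cases D with
  | NPC =>
    obtain ⟨hq0, -, hq2, hq3⟩ := MinresCall.npc_spec (f := f) hcall σ
    obtain ⟨α, hα⟩ := exists_forwardReturns hζ hζ'
      (exists_criterion_of_small hf hL hg hρ' hκ (min_le_left _ _) hε hx F hq3) (by
        have hn : 0 < ρ * ‖q‖ ^ 2 := by positivity
        refine ⟨(f x - fstar) / (ρ * ‖q‖ ^ 2) + 1, fun α hα hcrit => ?_⟩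
        rw [lineSearchCriterion_iff, hq2] at hcrit
        have hb := hfstar _ (proj_mem_orthant (x + α • direction f ε x F q))
        have h0 : 0 ≤ (f x - fstar) / (ρ * ‖q‖ ^ 2) :=
          div_nonneg (sub_nonneg.2 (hfstar x hx)) hn.le
        have h1 := mul_nonpos_of_nonneg_of_nonpos hρ.le
          (sum_active_disp_nonpos (f := f) (α := α) hx (by linarith) F q)
        have h2 : (f x - fstar) / (ρ * ‖q‖ ^ 2) < α := by linarith
        rw [div_lt_iff₀ hn] at h2
        linarith)
    exact ⟨_, F, t, q, DType.NPC, α, hF, hcall, hα, rfl⟩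
  | SOL =>
    obtain ⟨-, -, -, hq4⟩ := MinresCall.sol_spec hf hL hg hθ hε hσ hx hcall (hreg t q hcall)
    obtain ⟨α, hα⟩ := exists_backtrackReturns hζ hζ'
      (exists_criterion_of_small hf hL hg hρ' hκ (min_le_left _ _) hε hx F hq4)
    exact ⟨_, F, t, q, DType.SOL, α, hF, hcall, hα, rfl⟩

end Complexity

end NewtonMR

theorem theorem2 (Lg LH ω σ ρ θ ζ Δ : ℝ)
    (hLg : 0 ≤ Lg) (hLH : 0 ≤ LH) (hω : 0 < ω) (hσ : 0 < σ)
    (hρ : 0 < ρ) (hρ' : ρ < 1 / 2) (hθ : 0 < θ) (hζ : 0 < ζ) (hζ' : ζ < 1) :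
    ∃ C : ℝ, 0 < C ∧
      ∀ (d : ℕ) (f : EuclideanSpace ℝ (Fin d) → ℝ) (fstar : ℝ)
        (x₀ : EuclideanSpace ℝ (Fin d)) (εg : ℝ),
        ContDiff ℝ 2 f →
        (∀ x ∈ NewtonMR.orthant d, ∀ y ∈ NewtonMR.orthant d,
          ‖gradient f x - gradient f y‖ ≤ Lg * ‖x - y‖) →
        (∀ x ∈ NewtonMR.orthant d, ∀ y ∈ NewtonMR.orthant d,
          ‖NewtonMR.hess f x - NewtonMR.hess f y‖ ≤ LH * ‖x - y‖) →
        (∀ x ∈ NewtonMR.orthant d, fstar ≤ f x) →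
        x₀ ∈ NewtonMR.orthant d → f x₀ - fstar ≤ Δ →
        0 < εg → εg < 1 →
        NewtonMR.NPCResidualBound f ρ ζ θ (fun _ => √εg) (fun _ => √εg) x₀ ω →
        NewtonMR.KrylovRegularity f ρ ζ θ (fun _ => √εg) (fun _ => √εg) x₀ σ →
        -- the method terminates within `C εg^(-3/2)` iterations at an `εg`-FO point
        (∃ (K : ℕ) (xK : EuclideanSpace ℝ (Fin d)),
          (K : ℝ) ≤ C * εg ^ (-(3 / 2) : ℝ) ∧
          NewtonMR.IsIterate f ρ ζ θ (fun _ => √εg) (fun _ => √εg) x₀ K xK ∧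
          NewtonMR.flag f (√εg) (√εg) xK = none ∧
          xK ∈ NewtonMR.orthant d ∧ NewtonMR.IsFO f εg xK) ∧
        -- and this holds for every run: no run is longer, every iteration that starts is completed
        -- (MINRES and the line searches terminate), and a run can stop only at an `εg`-FO point
        (∀ (k : ℕ) (x : EuclideanSpace ℝ (Fin d)),
          NewtonMR.IsIterate f ρ ζ θ (fun _ => √εg) (fun _ => √εg) x₀ k x →
          (k : ℝ) ≤ C * εg ^ (-(3 / 2) : ℝ) ∧
          (NewtonMR.flag f (√εg) (√εg) x = none →
            x ∈ NewtonMR.orthant d ∧ NewtonMR.IsFO f εg x) ∧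
          (NewtonMR.flag f (√εg) (√εg) x ≠ none →
            ∃ x', NewtonMR.AlgStep f ρ ζ θ (√εg) (√εg) x x')) := by
  have hc := NewtonMR.decreaseConst_pos hLg hLH hω hσ hρ hρ' hθ hζ
  set c := NewtonMR.decreaseConst Lg LH ω σ ρ θ ζ with hc_def
  refine ⟨2 * |Δ| / c + 1, by positivity, ?_⟩
  intro d f fstar x₀ εg hf hg hH hfstar hx₀ hΔ hεg hεg' hnpc hreg
  set ε := √εg with hε_def
  have hε : 0 < ε := Real.sqrt_pos.2 hεg
  have hε' : ε < 1 := by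
    rw [hε_def, Real.sqrt_lt' one_pos]; simpa using hεg'
  have hpow : εg ^ (-(3 / 2) : ℝ) = (ε ^ 3)⁻¹ := by
    rw [hε_def, Real.sqrt_eq_rpow, ← Real.rpow_natCast, ← Real.rpow_mul hεg.le,
      ← Real.rpow_neg hεg.le]
    norm_num
  -- A run loses at least `c ε³` per pair of consecutive iterations; one iteration in advance is
  -- granted to a run that has just made a step without sufficient decrease.
  have hinv : ∀ k x, NewtonMR.IsIterate f ρ ζ θ (fun _ => ε) (fun _ => ε) x₀ k x →
      x ∈ NewtonMR.orthant d ∧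
      (f x ≤ f x₀ - k / 2 * (c * ε ^ 3) ∨
        (f x ≤ f x₀ - (k - 1) / 2 * (c * ε ^ 3) ∧
          NewtonMR.flag f ε ε x ≠ some NewtonMR.StepType.typeII)) := by
    intro k x hk
    have hcε : 0 < c * ε ^ 3 := by positivity
    induction hk with
    | zero => exact ⟨hx₀, Or.inl (by simp)⟩
    | @succ k x x' hkx hstep ih =>
      obtain ⟨hx, ih⟩ := ih
      have hne : NewtonMR.flag f ε ε x ≠ none := by
        obtain ⟨F, _, _, _, _, hF, _⟩ := hstep
        rw [hF]; simp
      obtain ⟨hx', hle, hdec⟩ := hstep.decrease hf hLg hLH hg hH hω hσ hρ hρ' hθ hζ hζ' hε hε' hx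
        (hnpc k x hkx hne) (hreg k x hkx hne)
      rw [← hc_def] at hdec
      refine ⟨hx', ?_⟩
      push_cast
      rcases ih with ih | ⟨ih, hflag⟩
      · rcases hdec with hdec | ⟨-, hdec⟩
        · left; linarith
        · right; exact ⟨by linarith, hdec⟩
      · rcases hdec with hdec | ⟨hdec, -⟩
        · left; linarith
        · exact absurd hdec hflag
  have hbound : ∀ k x, NewtonMR.IsIterate f ρ ζ θ (fun _ => ε) (fun _ => ε) x₀ k x →
      (k : ℝ) ≤ (2 * |Δ| / c + 1) * εg ^ (-(3 / 2) : ℝ) := by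
    intro k x hk
    obtain ⟨hx, h⟩ := hinv k x hk
    have hcε : 0 < c * ε ^ 3 := by positivity
    have h1 : (k - 1) / 2 * (c * ε ^ 3) ≤ |Δ| := by
      have h2 := hfstar x hx
      have h3 := le_abs_self Δ
      rcases h with h | ⟨h, -⟩ <;> linarith
    have hε3 : 0 < ε ^ 3 := by positivity
    have h4 : (1 : ℝ) ≤ (ε ^ 3)⁻¹ := (one_le_inv₀ hε3).2 (pow_le_one₀ hε.le hε'.le)
    have h5 : (k : ℝ) - 1 ≤ 2 * |Δ| / c * (ε ^ 3)⁻¹ := by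
      rw [← div_eq_mul_inv, div_div, le_div_iff₀ hcε]
      linarith
    rw [hpow]
    linarith
  have hsound : ∀ k x, NewtonMR.IsIterate f ρ ζ θ (fun _ => ε) (fun _ => ε) x₀ k x →
      NewtonMR.flag f ε ε x = none → x ∈ NewtonMR.orthant d ∧ NewtonMR.IsFO f εg x :=
    fun k x hk hnone => ⟨(hinv k x hk).1, NewtonMR.isFO_of_flag_eq_none hεg.le hnone⟩
  have hstep : ∀ k x, NewtonMR.IsIterate f ρ ζ θ (fun _ => ε) (fun _ => ε) x₀ k x →
      NewtonMR.flag f ε ε x ≠ none → ∃ x', NewtonMR.AlgStep f ρ ζ θ ε ε x x' :=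
    fun k x hk hne => NewtonMR.exists_algStep hf hLg hg hfstar hσ hρ hρ' hθ hζ hζ' hε
      (hinv k x hk).1 (hreg k x hk hne) hne
  refine ⟨?_, fun k x hk => ⟨hbound k x hk, hsound k x hk, hstep k x hk⟩⟩
  obtain ⟨K, xK, hK, hflag⟩ : ∃ K xK,
      NewtonMR.IsIterate f ρ ζ θ (fun _ => ε) (fun _ => ε) x₀ K xK ∧
        NewtonMR.flag f ε ε xK = none := by
    by_contra hcon
    push Not at hcon
    have hlong : ∀ k : ℕ, ∃ x, NewtonMR.IsIterate f ρ ζ θ (fun _ => ε) (fun _ => ε) x₀ k x := by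
      intro k
      induction k with
      | zero => exact ⟨x₀, .zero⟩
      | succ k ih =>
        obtain ⟨x, hx⟩ := ih
        obtain ⟨x', hx'⟩ := hstep k x hx (hcon k x hx)
        exact ⟨x', .succ hx hx'⟩
    obtain ⟨k, hk⟩ := exists_nat_gt ((2 * |Δ| / c + 1) * εg ^ (-(3 / 2) : ℝ))
    obtain ⟨x, hx⟩ := hlong k
    exact absurd (hbound k x hx) (not_le.2 hk)
  exact ⟨K, xK, hbound K xK hK, hK, hflag, hsound K xK hK hflag⟩
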